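/- **Setting.** Let $\mathcal C_0$ be a Barr exact category (finite limits, coequalisers of kernel pairs, pullback-stable regular epimorphisms, every internal equivalence relation is a kernel pair) and let $\mathcal E_1$ be its class of regular epimorphisms. For a category $\mathcal Y$ with a class $\mathcal E$ of morphisms (the *extensions*), a commutative square $\alpha=(\alpha_\top,\alpha_\bot)\colon f_A\to f_B$, where $f_A\colon A_\top\to A_\bot$ and $f_B\colon B_\top\to B_\bot$, is an *$\mathcal E$-double extension* if $f_A,f_B,\alpha_\top,\alpha_\bot$, the two projections of the pullback $A_\bot\times_{B_\bot}B_\top$ and the comparison $A_\top\to A_\bot\times_{B_\bot}B_\top$ all lie in $\mathcal E$. Inductively, $\mathcal C_{n+1}$ is the full subcategory of the arrow category of $\mathcal C_n$ on the arrows in $\mathcal E_{n+1}$, and $\mathcal E_{n+2}$ is the class of $\mathcal E_{n+1}$-double extensions, viewed as morphisms of $\mathcal C_{n+1}$. The objects of $\mathcal C_n$ are the *$n$-fold extensions*; the underlying $n$-cubical diagram $\{0\to1\}^n\to\mathcal C_0$ of such an object is called an *$n$-cubical extension*. A *tower of strongly Birkhoff Galois structures* over $\mathcal C_0$ consists, for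 each $n\ge 0$, of a full replete reflective subcategory $\mathcal B_n\subseteq\mathcal C_n$ with reflector $F_n$ and unit $\eta^n$ (the Galois structure $\Gamma_n$), such that all $\eta^n_A$ lie in $\mathcal E_{n+1}$; such that for each $f\colon A\to B$ in $\mathcal E_{n+1}$ the reflection square $(\eta^n_A,\eta^n_B)\colon f\to F_n(f)$ is an $\mathcal E_{n+1}$-double extension; and such that $\mathcal B_{n+1}$ consists of the $\Gamma_n$-coverings. Here a *trivial $\Gamma_n$-covering* is a morphism in $\mathcal E_{n+1}$ whose reflection square is a pullback, and a *$\Gamma_n$-covering* is a morphism in $\mathcal E_{n+1}$ whose pullback along some morphism in $\mathcal E_{n+1}$ is a trivial $\Gamma_n$-covering. A *discrete fibration of order $n+1$* from $\tau$ to $\alpha$, for $n$-fold extensions $\tau$ and $\alpha$, is an $(n+1)$-fold extension $\tau\to\alpha$ whose underlying $(n+1)$-cube in $\mathcal C_0$ is a limit cube: the cone out of its initial vertex is a limit of the diagram without that vertex. An $n$-cubical extension *lies in $\mathcal B_0$* if all its vertices do. An $n$-fold extension $\tau$ is a *symmetrically trivial covering* if there is a discrete fibration $\tau\to\beta$ of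 order $n+1$ with $\beta$ in $\mathcal B_0$; an $n$-fold extension $\alpha$ is a *symmetric covering* if there is a discrete fibration $\tau\to\alpha$ of order $n+1$ with $\tau$ a symmetrically trivial covering. **Theorem.** Let a tower of strongly Birkhoff Galois structures over a Barr exact category $\mathcal C_0$ be given, let $n\ge 2$, and let $\alpha$ be an $n$-fold extension. 1. $\alpha$ is a $\Gamma_{n-1}$-covering if and only if it is a symmetric covering. 2. $\alpha$ is a $\Gamma_{n-1}$-covering if and only if there is a span of discrete fibrations $\beta\leftarrow\tau\to\alpha$ of order $n+1$ in which $\beta$ is an $n$-cubical extension lying in $\mathcal B_0$. 3. Being a higher covering does not depend on the way the $n$-cube is read as an arrow between $(n-1)$-cubes: for every permutation $\sigma$ of the $n$ directions, the $n$-cube obtained from that of $\alpha$ by permuting its directions by $\sigma$ is (up to isomorphism) the underlying cube of an $n$-fold extension $\alpha'$, and for each such $\alpha'$, $\alpha$ is a $\Gamma_{n-1}$-covering if and only if $\alpha'$ is. -/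

import Mathlib

universe v u

namespace HigherCoverings

open CategoryTheory CategoryTheory.Limits

/-! ### Barr exact categories -/

section BarrExact

variable {C : Type u} [Category.{v} C]

/-- A pair `r₁, r₂ : R ⟶ X` is an (internal) equivalence relation on `X`: it is jointly monic, and
for each object `T` the induced relation on the set of morphisms `T ⟶ X` is an equivalence
relation. -/
structure IsEquivalenceRelation {R X : C} (r₁ r₂ : R ⟶ X) : Prop where
  jointly_mono : ∀ {T : C} (a b : T ⟶ R), a ≫ r₁ = b ≫ r₁ → a ≫ r₂ = b ≫ r₂ → a = b
  equivalence : ∀ T : C,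
    Equivalence fun a b : T ⟶ X => ∃ r : T ⟶ R, r ≫ r₁ = a ∧ r ≫ r₂ = b

variable (C) in
/-- A Barr exact category: a regular category in which every equivalence relation is effective,
i.e. is the kernel pair of some morphism. -/
class BarrExact : Prop extends Regular C where
  effective : ∀ {R X : C} (r₁ r₂ : R ⟶ X), IsEquivalenceRelation r₁ r₂ →
    ∃ (Y : C) (f : X ⟶ Y), IsKernelPair f r₁ r₂

end BarrExact

/-! ### Double extensions and the tower of extensions -/

section DoubleExtension

variable {Y : Type u} [Category.{v} Y]

/-- A morphism `α : f ⟶ g` of arrows, viewed as a commutative square with top `α.left` and bottom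
`α.right`, is an `E`-double extension if the four sides of the square, the projections of the
pullback `P` of `α.right` and `g.hom`, and the comparison map `p` to this pullback are all
in `E`. -/
structure IsDoubleExtension (E : MorphismProperty Y) {f g : Arrow Y} (α : f ⟶ g) : Prop where
  dom : E f.hom
  cod : E g.hom
  top : E α.left
  bottom : E α.right
  comparison : ∃ (P : Y) (π₁ : P ⟶ f.right) (π₂ : P ⟶ g.left) (p : f.left ⟶ P),
    IsPullback π₁ π₂ α.right g.hom ∧ p ≫ π₁ = f.hom ∧ p ≫ π₂ = α.left ∧
      E π₁ ∧ E π₂ ∧ E p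

/-- The category `Ext(Y)`: the full subcategory of the arrow category of `Y` whose objects are the
arrows in the class `E`. -/
abbrev ExtObj (E : MorphismProperty Y) : Type (max u v) :=
  ObjectProperty.FullSubcategory fun f : Arrow Y => E f.hom

/-- The class of `E`-double extensions, as a class of morphisms in `Ext(Y)`. -/
def doubleExtensions (E : MorphismProperty Y) : MorphismProperty (ExtObj E) :=
  fun _ _ φ => IsDoubleExtension E φ.hom

end DoubleExtension

/-- A category with a chosen class of morphisms, the extensions. -/
structure CatWithExt : Type (max (u + 1) (v + 1)) where
  Obj : Type u
  [cat : Category.{v} Obj]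
  ext : MorphismProperty Obj

attribute [instance] CatWithExt.cat

section Tower

variable (C : Type (max u v)) [Category.{v} C]

/-- The tower of extensions over `C`. At level `0` we have the category `C` with its regular
epimorphisms. At level `n + 1` we have the category of extensions of level `n`, with the double
extensions of level `n`. -/
def extTower : ℕ → CatWithExt.{v, max u v}
  | 0 => ⟨C, MorphismProperty.regularEpi C⟩
  | n + 1 => ⟨ExtObj (extTower n).ext, doubleExtensions (extTower n).ext⟩

/-- The category `Extⁿ(C)` of `n`-fold extensions in `C`, the `n`-th level of the tower. -/
abbrev NExt (n : ℕ) : Type (max u v) := (extTower.{v, u} C n).Obj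

/-- The class of extensions in the category `Extⁿ(C)`, that is, of `(n + 1)`-fold extensions. -/
abbrev extensions (n : ℕ) : MorphismProperty (NExt.{v, u} C n) := (extTower.{v, u} C n).ext

end Tower

section Cubes

variable {C : Type (max u v)} [Category.{v} C]

/-- An `(n + 1)`-fold extension, viewed as an arrow between `n`-fold extensions. -/
def NExt.toArrow {n : ℕ} (α : NExt.{v, u} C (n + 1)) : Arrow (NExt.{v, u} C n) :=
  ObjectProperty.FullSubcategory.obj (P := fun f : Arrow (NExt.{v, u} C n) =>
    extensions.{v, u} C n f.hom) α

/-- An extension in the category of `n`-fold extensions, viewed as an `(n + 1)`-fold extension. -/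
def NExt.ofHom {n : ℕ} {A B : NExt.{v, u} C n} (f : A ⟶ B) (hf : extensions.{v, u} C n f) :
    NExt.{v, u} C (n + 1) :=
  ObjectProperty.FullSubcategory.mk (P := fun f : Arrow (NExt.{v, u} C n) =>
    extensions.{v, u} C n f.hom) (Arrow.mk f) hf

/-- The functor which views an `(n + 1)`-fold extension as an arrow between `n`-fold extensions. -/
def NExt.forget (C : Type (max u v)) [Category.{v} C] (n : ℕ) :
    NExt.{v, u} C (n + 1) ⥤ Arrow (NExt.{v, u} C n) :=
  ObjectProperty.ι fun f : Arrow (NExt.{v, u} C n) => extensions.{v, u} C n f.hom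

/-- An arrow in `D`, viewed as a functor from the ordered set `false < true` to `D`. -/
def arrowToFunctor (D : Type u) [Category.{v} D] : Arrow D ⥤ (Bool ⥤ D) where
  obj f :=
    { obj := fun b => match b with
        | false => f.left
        | true => f.right
      map := fun {b b'} h => match b, b', h with
        | false, false, _ => 𝟙 f.left
        | false, true, _ => f.hom
        | true, true, _ => 𝟙 f.right
        | true, false, h => absurd (leOfHom h) (by decide)
      map_id := by rintro (_ | _) <;> rfl
      map_comp := by
        rintro (_ | _) (_ | _) (_ | _) h k
        all_goals first
          | exact absurd (leOfHom h) (by decide)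
          | exact absurd (leOfHom k) (by decide)
          | simp }
  map {f g} φ :=
    { app := fun b => match b with
        | false => φ.left
        | true => φ.right
      naturality := by
        rintro (_ | _) (_ | _) h
        all_goals first
          | exact absurd (leOfHom h) (by decide)
          | simp }
  map_id f := by ext (_ | _) <;> rfl
  map_comp φ ψ := by ext (_ | _) <;> rfl

/-- The category of `n`-cubical diagrams in `C`: functors to `C` from the product
category `{0 → 1}ⁿ`. -/
abbrev Cube (C : Type u) [Category.{v} C] (n : ℕ) := (Fin n → Bool) ⥤ C

/-- The identification of `{0 → 1}ⁿ⁺¹` with `{0 → 1} × {0 → 1}ⁿ`, separating the first coordinate. -/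
def splitFirst (n : ℕ) : (Fin (n + 1) → Bool) ⥤ Bool × (Fin n → Bool) where
  obj x := (x 0, fun i => x i.succ)
  map h := (h 0, fun i => h i.succ)

variable (C) in
/-- The underlying `n`-cubical diagram in `C` of an `n`-fold extension. The first coordinate is the
direction in which an `(n + 1)`-fold extension is an arrow between `n`-fold extensions. -/
def cube : ∀ n : ℕ, NExt.{v, u} C n ⥤ Cube C n
  | 0 => Functor.const (Fin 0 → Bool)
  | n + 1 => NExt.forget.{v, u} C n ⋙ (cube n).mapArrow ⋙ arrowToFunctor (Cube C n) ⋙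
      Functor.uncurry ⋙ (Functor.whiskeringLeft _ _ _).obj (splitFirst n)

end Cubes

section LimitCubes

variable {C : Type u} [Category.{v} C] {n : ℕ}

/-- The cone out of the initial object of an `n`-cubical diagram, on the diagram without that
initial object. -/
def Cube.initialCone (X : Cube C n) :
    Cone ((ObjectProperty.ι fun x : Fin n → Bool => x ≠ ⊥) ⋙ X) where
  pt := X.obj ⊥
  π :=
    { app := fun x => X.map (fun i => homOfLE (bot_le : ⊥ ≤ x.obj i))
      naturality := fun x y f => by
        dsimp
        rw [Category.id_comp, ← X.map_comp]
        rfl }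

/-- A limit cube: the cone out of the initial object is a limit of the rest of the diagram. -/
def Cube.IsLimitCube (X : Cube C n) : Prop := Nonempty (IsLimit X.initialCone)

/-- The `n`-cubical diagram obtained by permuting the directions: the `i`-th direction of the new
cube is the `σ i`-th direction of `X`. -/
def Cube.permute (σ : Equiv.Perm (Fin n)) (X : Cube C n) : Cube C n :=
  { obj := fun x i => x (σ.symm i)
    map := fun h i => h (σ.symm i) : (Fin n → Bool) ⥤ (Fin n → Bool) } ⋙ X

end LimitCubes

/-! ### Galois structures and coverings -/

/-- A Galois structure on a category `Y` with class of extensions `E`: a full replete reflective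
subcategory `X` of `Y` all of whose units are extensions. (The usual further requirements on `E`
are not imposed here: the class of `(n + 1)`-fold extensions over a Barr exact category contains
the isomorphisms, is closed under composition, has the needed pullbacks, is stable under them, and
consists of morphisms of effective descent. That the reflector preserves extensions is part of the
strong Birkhoff condition below.) -/
structure GaloisStructure (Y : Type u) [Category.{v} Y] (E : MorphismProperty Y) where
  /-- the objects of the reflective subcategory -/
  X : ObjectProperty Y
  replete : X.IsClosedUnderIsomorphisms
  /-- the reflector -/
  L : Y ⥤ X.FullSubcategory
  /-- the adjunction between the reflector and the inclusion -/
  adj : L ⊣ X.ι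
  unit_mem : ∀ A : Y, E (adj.unit.app A)

namespace GaloisStructure

variable {Y : Type u} [Category.{v} Y] {E : MorphismProperty Y} (Γ : GaloisStructure Y E)

/-- The reflection of an object, seen in `Y`. -/
def refl (A : Y) : Y := Γ.X.ι.obj (Γ.L.obj A)

/-- The reflection of a morphism, seen in `Y`. -/
def reflMap {A B : Y} (f : A ⟶ B) : Γ.refl A ⟶ Γ.refl B := Γ.X.ι.map (Γ.L.map f)

/-- The unit of the reflection. -/
def unit (A : Y) : A ⟶ Γ.refl A := Γ.adj.unit.app A

/-- The reflection square at `f`, as a morphism of arrows from `f` to its reflection. -/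
def reflectionSquare {A B : Y} (f : A ⟶ B) : Arrow.mk f ⟶ Arrow.mk (Γ.reflMap f) :=
  Arrow.homMk (Γ.unit A) (Γ.unit B) (Γ.adj.unit.naturality f).symm

/-- The strong Birkhoff condition: the reflection square at each extension is a double extension. -/
def StronglyBirkhoff : Prop :=
  ∀ ⦃A B : Y⦄ (f : A ⟶ B), E f → IsDoubleExtension E (Γ.reflectionSquare f)

/-- A trivial covering: an extension whose reflection square is a pullback. -/
def IsTrivialCovering {T S : Y} (t : T ⟶ S) : Prop :=
  E t ∧ IsPullback (Γ.unit T) t (Γ.reflMap t) (Γ.unit S)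

/-- A covering: an extension `c` whose pullback `t` along some extension `e` is a trivial
covering. -/
def IsCovering {A B : Y} (c : A ⟶ B) : Prop :=
  E c ∧ ∃ (S : Y) (e : S ⟶ B), E e ∧
    ∃ (T : Y) (t : T ⟶ S) (a : T ⟶ A), IsPullback a t c e ∧ Γ.IsTrivialCovering t

end GaloisStructure

/-- A tower of strongly Birkhoff Galois structures over `C`: a strongly Birkhoff Galois structure
`Γ n` on the category of `n`-fold extensions, with the `(n + 1)`-fold extensions as its extensions,
for each `n`, such that the reflective subcategory at level `n + 1` is the category of
`Γ n`-coverings. -/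
structure GaloisTower (C : Type (max u v)) [Category.{v} C] where
  Γ : ∀ n : ℕ, GaloisStructure (NExt.{v, u} C n) (extensions.{v, u} C n)
  stronglyBirkhoff : ∀ n : ℕ, (Γ n).StronglyBirkhoff
  mem_succ_iff : ∀ (n : ℕ) (A : NExt.{v, u} C (n + 1)),
    (Γ (n + 1)).X A ↔ (Γ n).IsCovering A.toArrow.hom

/-! ### Discrete fibrations and symmetric coverings -/

section Symmetric

variable {C : Type (max u v)} [Category.{v} C]

/-- A discrete fibration of order `n + 1` from `τ` to `α`: an `(n + 1)`-fold extension, viewed as an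
arrow from `τ` to `α`, whose underlying `(n + 1)`-cubical diagram in `C` is a limit cube. -/
def IsDiscreteFibration {n : ℕ} {τ α : NExt.{v, u} C n} (φ : τ ⟶ α) : Prop :=
  ∃ h : extensions.{v, u} C n φ,
    Cube.IsLimitCube ((cube.{v, u} C (n + 1)).obj (NExt.ofHom φ h))

namespace GaloisTower

variable (T : GaloisTower.{v, u} C)

/-- The `n`-cubical extension `β` lies in the base category `B₀`: all its vertices do. -/
def LiesInBase {n : ℕ} (β : NExt.{v, u} C n) : Prop :=
  ∀ x : Fin n → Bool, (T.Γ 0).X (((cube.{v, u} C n).obj β).obj x)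

/-- The `(n + 1)`-fold extension `α` is a `Γ n`-covering. -/
def IsCovering {n : ℕ} (α : NExt.{v, u} C (n + 1)) : Prop :=
  (T.Γ n).IsCovering α.toArrow.hom

/-- Symmetrically trivial coverings: there is a discrete fibration to an extension in the base. -/
def IsSymmetricallyTrivialCovering {n : ℕ} (τ : NExt.{v, u} C n) : Prop :=
  ∃ (β : NExt.{v, u} C n) (φ : τ ⟶ β), IsDiscreteFibration φ ∧ T.LiesInBase β

/-- Symmetric coverings: there is a discrete fibration from a symmetrically trivial covering. -/
def IsSymmetricCovering {n : ℕ} (α : NExt.{v, u} C n) : Prop :=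
  ∃ (τ : NExt.{v, u} C n) (ψ : τ ⟶ α), IsDiscreteFibration ψ ∧
    T.IsSymmetricallyTrivialCovering τ

end GaloisTower

end Symmetric

end HigherCoverings

/-!
Coverings are stable under pullback along discrete fibrations, and they descend along them. An
extension all of whose vertices lie in the base belongs to every reflective subcategory of the
tower, so it is a covering; hence a span of discrete fibrations from it to `α` makes `α` a covering.

Conversely, every multiple extension `α` admits a discrete fibration `τ → α` such that the
reflection of `τ` among the coverings, followed by a discrete fibration, is the reflection of all
vertices of `τ` into the base. Such a `τ` is built by pulling `α` back, one direction after another,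
along extensions which trivialise the reflections of its faces: a reflection of one face then
extends, by a pullback, to the cube. If `α` is a covering, then so is `τ`, which therefore is its
own reflection, and what remains is a discrete fibration from `τ` to an extension with all vertices
in the base.

Neither discrete fibrations nor extensions depend on the order of the directions. A matching family
of a morphism of cubes at a vertex consists of elements of the source beyond that vertex together
with a compatible element of the target at it. A morphism of multiple extensions is an extension
when every matching family can be filled after restriction along a regular epimorphism, and then it
is a discrete fibration when those at the initial vertex can be filled uniquely; a cube underlies an
extension when the first condition holds for some morphism from it to a constant cube.
-/

namespace HigherCoverings

open CategoryTheory CategoryTheory.Limits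

/-! ### Classes of extensions -/

section ExtensionClass

variable {Y : Type u} [Category.{v} Y]

/-- The closure properties shared by the classes of `n`-fold extensions over a regular category:
they form a stable class of epimorphisms along which isomorphisms descend. -/
class IsExtensionClass (E : MorphismProperty Y) : Prop extends E.IsMultiplicative,
    E.IsStableUnderBaseChange, E.HasPullbacks, E.HasOfPrecompProperty E where
  isIso_of_isPullback {A B S P : Y} {a : P ⟶ A} {b : P ⟶ S} {f : A ⟶ B} {g : S ⟶ B} :
    IsPullback a b f g → E g → IsIso b → IsIso f
  epi {A B : Y} {f : A ⟶ B} : E f → Epi f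

variable {E : MorphismProperty Y} [IsExtensionClass E]

lemma exists_isPullback_of_mem {A B S : Y} {f : A ⟶ B} (hf : E f) (g : S ⟶ B) :
    ∃ (P : Y) (a : P ⟶ A) (b : P ⟶ S), IsPullback a b f g :=
  have := E.hasPullback g hf
  ⟨_, _, _, IsPullback.of_hasPullback f g⟩

lemma isIso_of_mem_of_mono {A B : Y} {f : A ⟶ B} (hf : E f) [Mono f] : IsIso f :=
  IsExtensionClass.isIso_of_isPullback (IsKernelPair.id_of_mono f) hf inferInstance

end ExtensionClass

section Regular

variable {C : Type u} [Category.{v} C] [Regular C]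

lemma isRegularEpi_iff_strongEpi {A B : C} (f : A ⟶ B) : IsRegularEpi f ↔ StrongEpi f :=
  ⟨fun _ => inferInstance, fun _ => inferInstance⟩

lemma mono_of_isPullback_of_isRegularEpi {A B S P : C} {a : P ⟶ A} {b : P ⟶ S} {f : A ⟶ B}
    {g : S ⟶ B} (h : IsPullback a b f g) [IsRegularEpi g] [Mono b] : Mono f where
  right_cancellation x y hxy := by
    have hx := h.lift_fst (pullback.snd g (x ≫ f) ≫ x) (pullback.fst g (x ≫ f))
      (by rw [Category.assoc, pullback.condition])
    have hy := h.lift_fst (pullback.snd g (x ≫ f) ≫ y) (pullback.fst g (x ≫ f))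
      (by rw [Category.assoc, ← hxy, pullback.condition])
    rw [← cancel_epi (pullback.snd g (x ≫ f)), ← hx, ← hy]
    congr 1
    rw [← cancel_mono b, h.lift_snd, h.lift_snd]

instance isExtensionClass_regularEpi : IsExtensionClass (MorphismProperty.regularEpi C) where
  comp_mem f g hf hg := by
    have := (isRegularEpi_iff_strongEpi f).1 hf
    have := (isRegularEpi_iff_strongEpi g).1 hg
    exact (isRegularEpi_iff_strongEpi _).2 (strongEpi_comp f g)
  toIsStableUnderBaseChange := Regular.regularEpiIsStableUnderBaseChange
  of_precomp f g _ hfg := by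
    have := (isRegularEpi_iff_strongEpi (f ≫ g)).1 hfg
    exact (isRegularEpi_iff_strongEpi g).2 (strongEpi_of_strongEpi f g)
  isIso_of_isPullback {_ _ _ _ a b f g} h (hg : IsRegularEpi g) (_ : IsIso b) := by
    have : Mono f := mono_of_isPullback_of_isRegularEpi h
    have : StrongEpi ((inv b ≫ a) ≫ f) := by
      rw [Category.assoc, h.w, IsIso.inv_hom_id_assoc]
      infer_instance
    have : StrongEpi f := strongEpi_of_strongEpi (inv b ≫ a) f
    exact isIso_of_mono_of_strongEpi f
  epi {_ _ f} hf := by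
    have := (isRegularEpi_iff_strongEpi f).1 hf
    infer_instance

end Regular

/-! ### Comparison morphisms of squares -/

section Comparison

variable {Y : Type u} [Category.{v} Y]

/-- The morphism `p` is the comparison of the commutative square with left side `k`, top `t`,
bottom `b` and right side `m` with a pullback of `b` along `m`, whose projections are `π₁`
and `π₂`. -/
structure IsComparison {A A' B B' P : Y} (k : A ⟶ B) (t : A ⟶ A') (b : B ⟶ B') (m : A' ⟶ B')
    (π₁ : P ⟶ B) (π₂ : P ⟶ A') (p : A ⟶ P) : Prop where
  isPullback : IsPullback π₁ π₂ b m
  fst : p ≫ π₁ = k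
  snd : p ≫ π₂ = t

/-- The comparison of a commutative square (sides as in `IsComparison`) with the pullback exists
and lies in the class `W`. -/
def HasComparisonIn (W : MorphismProperty Y) {A A' B B' : Y} (k : A ⟶ B) (t : A ⟶ A')
    (b : B ⟶ B') (m : A' ⟶ B') : Prop :=
  ∃ (P : Y) (π₁ : P ⟶ B) (π₂ : P ⟶ A') (p : A ⟶ P), IsComparison k t b m π₁ π₂ p ∧ W p

variable {A A' A'' B B' B'' P Q R : Y} {k : A ⟶ B} {t : A ⟶ A'} {b : B ⟶ B'} {m : A' ⟶ B'}
  {π₁ : P ⟶ B} {π₂ : P ⟶ A'} {p : A ⟶ P}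

lemma isComparison_lift (h : IsPullback π₁ π₂ b m) (w : t ≫ m = k ≫ b) :
    IsComparison k t b m π₁ π₂ (h.lift k t w.symm) :=
  ⟨h, h.lift_fst _ _ _, h.lift_snd _ _ _⟩

lemma isComparison_id_of_isPullback (h : IsPullback k t b m) : IsComparison k t b m k t (𝟙 A) :=
  ⟨h, Category.id_comp k, Category.id_comp t⟩

lemma HasComparisonIn.mono {W W' : MorphismProperty Y} (hW : W ≤ W')
    (h : HasComparisonIn W k t b m) : HasComparisonIn W' k t b m := by
  obtain ⟨P, π₁, π₂, p, hp, hpW⟩ := h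
  exact ⟨P, π₁, π₂, p, hp, hW p hpW⟩

lemma HasComparisonIn.mem {W : MorphismProperty Y} [W.RespectsIso]
    (h : HasComparisonIn W k t b m) (hp : IsComparison k t b m π₁ π₂ p) : W p := by
  obtain ⟨Q, q₁, q₂, q, hq, hqW⟩ := h
  have hpq : p = q ≫ (hq.isPullback.isoIsPullback _ _ hp.isPullback).hom := by
    apply hp.isPullback.hom_ext
    · rw [hp.fst, Category.assoc, IsPullback.isoIsPullback_hom_fst, hq.fst]
    · rw [hp.snd, Category.assoc, IsPullback.isoIsPullback_hom_snd, hq.snd]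
  rw [hpq]
  exact (W.cancel_right_of_respectsIso _ _).2 hqW

lemma IsComparison.exists_comp {t' : A' ⟶ A''} {b' : B' ⟶ B''} {l : A'' ⟶ B''} {q₁ : Q ⟶ B'}
    {q₂ : Q ⟶ A''} {q : A' ⟶ Q} {r₁ : R ⟶ B} {y : R ⟶ Q} (hp : IsComparison k t b m π₁ π₂ p)
    (hq : IsComparison m t' b' l q₁ q₂ q) (hR : IsPullback r₁ y b q₁) :
    ∃ s : P ⟶ R, IsComparison k (t ≫ t') (b ≫ b') l r₁ (y ≫ q₂) (p ≫ s) ∧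
      IsPullback π₂ s q y := by
  let s : P ⟶ R := hR.lift π₁ (π₂ ≫ q) (by rw [hp.isPullback.w, Category.assoc, hq.fst])
  refine ⟨s, ⟨(hR.flip.paste_horiz hq.isPullback.flip).flip, ?_, ?_⟩, ?_⟩
  · rw [Category.assoc, hR.lift_fst, hp.fst]
  · rw [Category.assoc, hR.lift_snd_assoc, Category.assoc, hq.snd, ← hp.snd, Category.assoc]
  · refine IsPullback.of_bot (v₂₁ := r₁) (v₂₂ := q₁) (h₃₁ := b) ?_ (hR.lift_snd _ _ _).symm hR.flip
    rw [hR.lift_fst, hq.fst]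
    exact hp.isPullback.flip

/-- The squares form a cube, with `(ta, ba, tg, bg)` a morphism from the square of `r` to that of
`p`; it is a pullback in the horizontal direction. -/
lemma IsComparison.exists_isPullback {D D' E E' : Y} {j : D ⟶ E} {tc : D ⟶ D'} {bc : E ⟶ E'}
    {l : D' ⟶ E'} {ta : D ⟶ A} {ba : E ⟶ B} {tg : D' ⟶ A'} {bg : E' ⟶ B'} {r₁ : R ⟶ E}
    {r₂ : R ⟶ D'} {r : D ⟶ R} (hp : IsComparison k t b m π₁ π₂ p)
    (hr : IsComparison j tc bc l r₁ r₂ r) (ht : IsPullback ta tc t tg)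
    (hb : IsPullback ba bc b bg) (ha : ta ≫ k = j ≫ ba) (hg : tg ≫ m = l ≫ bg) :
    ∃ z : R ⟶ P, IsPullback ta r p z ∧ IsPullback z r₂ π₂ tg := by
  have hR : IsPullback (r₁ ≫ ba) r₂ b (l ≫ bg) := (hr.isPullback.flip.paste_vert hb.flip).flip
  let z : R ⟶ P := hp.isPullback.lift (r₁ ≫ ba) (r₂ ≫ tg) (by rw [hR.w, Category.assoc, hg])
  have hz : IsPullback z r₂ π₂ tg := by
    refine IsPullback.of_right (h₁₂ := π₁) (v₁₃ := b) (h₂₂ := m) ?_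
      (hp.isPullback.lift_snd _ _ _) hp.isPullback
    rw [hp.isPullback.lift_fst, hg]
    exact hR
  refine ⟨z, IsPullback.of_bot (v₂₁ := r₂) (v₂₂ := π₂) (h₃₁ := tg) ?_ ?_ hz, hz⟩
  · rw [hr.snd, hp.snd]
    exact ht
  · apply hp.isPullback.hom_ext
    · rw [Category.assoc, Category.assoc, hp.fst, hp.isPullback.lift_fst, reassoc_of% hr.fst, ha]
    · rw [Category.assoc, Category.assoc, hp.snd, hp.isPullback.lift_snd, reassoc_of% hr.snd, ht.w]

end Comparison

/-! ### Higher extensions as arrows -/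

namespace NExt

variable {C : Type (max u v)} [Category.{v} C] {n : ℕ}

section Basic

/-- The domain of an `(n + 1)`-fold extension. -/
def top (κ : NExt.{v, u} C (n + 1)) : NExt.{v, u} C n := κ.toArrow.left

/-- The codomain of an `(n + 1)`-fold extension. -/
def bot (κ : NExt.{v, u} C (n + 1)) : NExt.{v, u} C n := κ.toArrow.right

/-- An `(n + 1)`-fold extension as a morphism of `n`-fold extensions. -/
def arr (κ : NExt.{v, u} C (n + 1)) : top κ ⟶ bot κ := κ.toArrow.hom

lemma arr_mem (κ : NExt.{v, u} C (n + 1)) : extensions.{v, u} C n (arr κ) :=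
  ObjectProperty.FullSubcategory.property κ

variable {κ μ ν π : NExt.{v, u} C (n + 1)}

/-- The upper component of a morphism of `(n + 1)`-fold extensions. -/
def topMap (f : κ ⟶ μ) : top κ ⟶ top μ := ((forget C n).map f).left

/-- The lower component of a morphism of `(n + 1)`-fold extensions. -/
def botMap (f : κ ⟶ μ) : bot κ ⟶ bot μ := ((forget C n).map f).right

lemma w (f : κ ⟶ μ) : topMap f ≫ arr μ = arr κ ≫ botMap f := ((forget C n).map f).w

/-- The morphism of `(n + 1)`-fold extensions with given components. -/
def homMk (t : top κ ⟶ top μ) (b : bot κ ⟶ bot μ) (h : t ≫ arr μ = arr κ ≫ b) : κ ⟶ μ :=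
  ObjectProperty.homMk (Arrow.homMk t b h)

@[simp]
lemma topMap_id (κ : NExt.{v, u} C (n + 1)) : topMap (𝟙 κ) = 𝟙 _ := rfl

@[simp]
lemma botMap_id (κ : NExt.{v, u} C (n + 1)) : botMap (𝟙 κ) = 𝟙 _ := rfl

@[simp]
lemma topMap_comp (f : κ ⟶ μ) (g : μ ⟶ ν) : topMap (f ≫ g) = topMap f ≫ topMap g := rfl

@[simp]
lemma botMap_comp (f : κ ⟶ μ) (g : μ ⟶ ν) : botMap (f ≫ g) = botMap f ≫ botMap g := rfl

lemma hom_ext {f g : κ ⟶ μ} (ht : topMap f = topMap g) (hb : botMap f = botMap g) : f = g :=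
  ObjectProperty.hom_ext _ (Arrow.hom_ext _ _ ht hb)

/-- The isomorphism of `(n + 1)`-fold extensions with given components. -/
def isoMk (t : top κ ≅ top μ) (b : bot κ ≅ bot μ) (h : t.hom ≫ arr μ = arr κ ≫ b.hom) :
    κ ≅ μ where
  hom := homMk t.hom b.hom h
  inv := homMk t.inv b.inv (by
    rw [Iso.inv_comp_eq, ← Category.assoc, h, Category.assoc, Iso.hom_inv_id, Category.comp_id])
  hom_inv_id := hom_ext t.hom_inv_id b.hom_inv_id
  inv_hom_id := hom_ext t.inv_hom_id b.inv_hom_id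

instance (f : κ ⟶ μ) [IsIso f] : IsIso (topMap f) :=
  ⟨topMap (inv f), by rw [← topMap_comp, IsIso.hom_inv_id, topMap_id],
    by rw [← topMap_comp, IsIso.inv_hom_id, topMap_id]⟩

instance (f : κ ⟶ μ) [IsIso f] : IsIso (botMap f) :=
  ⟨botMap (inv f), by rw [← botMap_comp, IsIso.hom_inv_id, botMap_id],
    by rw [← botMap_comp, IsIso.inv_hom_id, botMap_id]⟩

lemma isIso_of_components (f : κ ⟶ μ) (ht : IsIso (topMap f)) (hb : IsIso (botMap f)) :
    IsIso f := by
  have hf : f = (isoMk (asIso (topMap f)) (asIso (botMap f)) (w f)).hom := hom_ext rfl rfl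
  rw [hf]
  infer_instance

lemma topMap_comm {a : π ⟶ κ} {b : π ⟶ ν} {f : κ ⟶ μ} {g : ν ⟶ μ} (h : a ≫ f = b ≫ g) :
    topMap a ≫ topMap f = topMap b ≫ topMap g := by
  rw [← topMap_comp, h, topMap_comp]

lemma botMap_comm {a : π ⟶ κ} {b : π ⟶ ν} {f : κ ⟶ μ} {g : ν ⟶ μ} (h : a ≫ f = b ≫ g) :
    botMap a ≫ botMap f = botMap b ≫ botMap g := by
  rw [← botMap_comp, h, botMap_comp]

lemma isPullback_of_components {a : π ⟶ κ} {b : π ⟶ ν} {f : κ ⟶ μ} {g : ν ⟶ μ}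
    (ht : IsPullback (topMap a) (topMap b) (topMap f) (topMap g))
    (hb : IsPullback (botMap a) (botMap b) (botMap f) (botMap g)) : IsPullback a b f g :=
  IsPullback.mk' (hom_ext ht.w hb.w)
    (fun _ φ ψ h₁ h₂ => hom_ext (ht.hom_ext (topMap_comm h₁) (topMap_comm h₂))
      (hb.hom_ext (botMap_comm h₁) (botMap_comm h₂)))
    (fun τ x y h => ⟨homMk (ht.lift (topMap x) (topMap y) (topMap_comm h))
      (hb.lift (botMap x) (botMap y) (botMap_comm h)) (by
        apply hb.hom_ext
        · rw [Category.assoc, Category.assoc, ← w, ht.lift_fst_assoc, hb.lift_fst, w]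
        · rw [Category.assoc, Category.assoc, ← w, ht.lift_snd_assoc, hb.lift_snd, w]),
      hom_ext (ht.lift_fst _ _ _) (hb.lift_fst _ _ _),
      hom_ext (ht.lift_snd _ _ _) (hb.lift_snd _ _ _)⟩)

/-- The morphisms of `(n + 1)`-fold extensions whose lower component is an extension and whose
comparison lies in `W`. Both the extensions and the discrete fibrations of each level arise in this
way from those of the level below. -/
def comparisonIn (W : MorphismProperty (NExt.{v, u} C n)) :
    MorphismProperty (NExt.{v, u} C (n + 1)) := fun κ μ f =>
  extensions.{v, u} C n (botMap f) ∧ HasComparisonIn W (arr κ) (topMap f) (botMap f) (arr μ)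

lemma comparisonIn_mono {W W' : MorphismProperty (NExt.{v, u} C n)} (hW : W ≤ W') :
    comparisonIn W ≤ comparisonIn W' :=
  fun _ _ _ h => ⟨h.1, h.2.mono hW⟩

end Basic

section Step

variable [IsExtensionClass (extensions.{v, u} C n)] {κ μ ν π : NExt.{v, u} C (n + 1)}

lemma extensions_succ : extensions.{v, u} C (n + 1) = comparisonIn (extensions.{v, u} C n) := by
  ext κ μ f
  constructor
  · intro hf
    obtain ⟨P, π₁, π₂, p, hP, h₁, h₂, -, -, hp⟩ := IsDoubleExtension.comparison hf
    exact ⟨IsDoubleExtension.bottom hf, P, π₁, π₂, p, ⟨hP, h₁, h₂⟩, hp⟩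
  · rintro ⟨hb, P, π₁, π₂, p, ⟨hP, h₁, h₂⟩, hp⟩
    have hπ₂ : extensions.{v, u} C n π₂ := MorphismProperty.of_isPullback hP hb
    exact
      { dom := arr_mem κ
        cod := arr_mem μ
        top := by
          have ht := (extensions.{v, u} C n).comp_mem p π₂ hp hπ₂
          rwa [h₂] at ht
        bottom := hb
        comparison := ⟨P, π₁, π₂, p, hP, h₁, h₂,
          MorphismProperty.of_isPullback hP.flip (arr_mem μ), hπ₂, hp⟩ }

lemma mem_succ_iff {f : κ ⟶ μ} : extensions.{v, u} C (n + 1) f ↔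
    extensions.{v, u} C n (botMap f) ∧
      HasComparisonIn (extensions.{v, u} C n) (arr κ) (topMap f) (botMap f) (arr μ) := by
  rw [extensions_succ]
  rfl

end Step

lemma topMap_mem {κ μ : NExt.{v, u} C (n + 1)} {f : κ ⟶ μ} (hf : extensions.{v, u} C (n + 1) f) :
    extensions.{v, u} C n (topMap f) :=
  IsDoubleExtension.top hf

lemma botMap_mem {κ μ : NExt.{v, u} C (n + 1)} {f : κ ⟶ μ} (hf : extensions.{v, u} C (n + 1) f) :
    extensions.{v, u} C n (botMap f) :=
  IsDoubleExtension.bottom hf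

section ComparisonIn

variable [IsExtensionClass (extensions.{v, u} C n)] {κ μ ν π : NExt.{v, u} C (n + 1)}
  {W : MorphismProperty (NExt.{v, u} C n)}

lemma comparisonIn_of_isIso [W.ContainsIdentities] (f : κ ⟶ μ) [IsIso f] : comparisonIn W f :=
  ⟨(extensions.{v, u} C n).of_isIso _, _, _, _, _,
    isComparison_id_of_isPullback (IsPullback.of_vert_isIso ⟨(w f).symm⟩), W.id_mem _⟩

lemma comparisonIn_comp [W.IsStableUnderBaseChange] [W.IsStableUnderComposition]
    {f : κ ⟶ μ} {g : μ ⟶ ν} (hf : comparisonIn W f) (hg : comparisonIn W g) :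
    comparisonIn W (f ≫ g) := by
  obtain ⟨hbf, P, p₁, p₂, p, hp, hpW⟩ := hf
  obtain ⟨hbg, Q, q₁, q₂, q, hq, hqW⟩ := hg
  obtain ⟨R, r₁, y, hR⟩ := exists_isPullback_of_mem hbf q₁
  obtain ⟨s, hs, hsq⟩ := hp.exists_comp hq hR
  exact ⟨(extensions.{v, u} C n).comp_mem _ _ hbf hbg, R, r₁, y ≫ q₂, p ≫ s, hs,
    W.comp_mem _ _ hpW (W.of_isPullback hsq hqW)⟩

lemma exists_isPullback_components {f : κ ⟶ μ} (hf : extensions.{v, u} C (n + 1) f) (g : ν ⟶ μ) :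
    ∃ (π : NExt.{v, u} C (n + 1)) (a : π ⟶ κ) (c : π ⟶ ν),
      IsPullback (topMap a) (topMap c) (topMap f) (topMap g) ∧
      IsPullback (botMap a) (botMap c) (botMap f) (botMap g) := by
  obtain ⟨hbf, P, p₁, p₂, p, hp, hpE⟩ := mem_succ_iff.1 hf
  obtain ⟨A, ta, tc, ht⟩ := exists_isPullback_of_mem (topMap_mem hf) (topMap g)
  obtain ⟨B, ba, bc, hb⟩ := exists_isPullback_of_mem (botMap_mem hf) (botMap g)
  have hbc : extensions.{v, u} C n bc := MorphismProperty.of_isPullback hb hbf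
  obtain ⟨R, r₁, r₂, hR⟩ := exists_isPullback_of_mem hbc (arr ν)
  let j : A ⟶ B := hb.lift (ta ≫ arr κ) (tc ≫ arr ν) (by
    rw [Category.assoc, Category.assoc, ← w, ← w, ← Category.assoc, ht.w, Category.assoc])
  have hr := isComparison_lift (k := j) hR (hb.lift_snd _ _ _).symm
  obtain ⟨z, hz, -⟩ := hp.exists_isPullback hr ht hb (hb.lift_fst _ _ _).symm (w g)
  have hj : extensions.{v, u} C n j := by
    rw [← hr.fst]
    exact MorphismProperty.comp_mem _ _ _ (MorphismProperty.of_isPullback hz hpE)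
      (MorphismProperty.of_isPullback hR.flip (arr_mem ν))
  exact ⟨ofHom j hj, homMk ta ba (hb.lift_fst _ _ _).symm, homMk tc bc (hb.lift_snd _ _ _).symm,
    ht, hb⟩

lemma isPullback_components {a : π ⟶ κ} {c : π ⟶ ν} {f : κ ⟶ μ} {g : ν ⟶ μ}
    (h : IsPullback a c f g) (hf : extensions.{v, u} C (n + 1) f) :
    IsPullback (topMap a) (topMap c) (topMap f) (topMap g) ∧
      IsPullback (botMap a) (botMap c) (botMap f) (botMap g) := by
  obtain ⟨π', a', c', ht, hb⟩ := exists_isPullback_components hf g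
  have h' := isPullback_of_components ht hb
  let e := h.isoIsPullback _ _ h'
  have ha : a = e.hom ≫ a' := (h.isoIsPullback_hom_fst _ _ h').symm
  have hc : c = e.hom ≫ c' := (h.isoIsPullback_hom_snd _ _ h').symm
  exact ⟨ht.of_iso' (asIso (topMap e.hom)) (Iso.refl _) (Iso.refl _) (Iso.refl _)
      (by simp [ha]) (by simp [hc]) (by simp) (by simp),
    hb.of_iso' (asIso (botMap e.hom)) (Iso.refl _) (Iso.refl _) (Iso.refl _)
      (by simp [ha]) (by simp [hc]) (by simp) (by simp)⟩

lemma isPullback_topMap {a : π ⟶ κ} {c : π ⟶ ν} {f : κ ⟶ μ} {g : ν ⟶ μ}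
    (h : IsPullback a c f g) (hf : extensions.{v, u} C (n + 1) f) :
    IsPullback (topMap a) (topMap c) (topMap f) (topMap g) :=
  (isPullback_components h hf).1

lemma isPullback_botMap {a : π ⟶ κ} {c : π ⟶ ν} {f : κ ⟶ μ} {g : ν ⟶ μ}
    (h : IsPullback a c f g) (hf : extensions.{v, u} C (n + 1) f) :
    IsPullback (botMap a) (botMap c) (botMap f) (botMap g) :=
  (isPullback_components h hf).2

lemma exists_comparison_isPullback {a : π ⟶ κ} {c : π ⟶ ν} {f : κ ⟶ μ} {g : ν ⟶ μ}
    (h : IsPullback a c f g) (hf : extensions.{v, u} C (n + 1) f)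
    {P : NExt.{v, u} C n} {p₁ : P ⟶ bot κ} {p₂ : P ⟶ top μ} {p : top κ ⟶ P}
    (hp : IsComparison (arr κ) (topMap f) (botMap f) (arr μ) p₁ p₂ p) :
    ∃ (R : NExt.{v, u} C n) (r₁ : R ⟶ bot π) (r₂ : R ⟶ top ν) (r : top π ⟶ R) (z : R ⟶ P),
      IsComparison (arr π) (topMap c) (botMap c) (arr ν) r₁ r₂ r ∧
      IsPullback (topMap a) r p z ∧ IsPullback z r₂ p₂ (topMap g) := by
  have hb := isPullback_botMap h hf
  obtain ⟨R, r₁, r₂, hR⟩ :=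
    exists_isPullback_of_mem (MorphismProperty.of_isPullback hb (botMap_mem hf)) (arr ν)
  have hr := isComparison_lift hR (w c)
  obtain ⟨z, hz, hz'⟩ := hp.exists_isPullback hr (isPullback_topMap h hf) hb (w a) (w g)
  exact ⟨R, r₁, r₂, _, z, hr, hz, hz'⟩

lemma comparisonIn_of_isPullback [W.IsStableUnderBaseChange] {a : π ⟶ κ} {c : π ⟶ ν} {f : κ ⟶ μ}
    {g : ν ⟶ μ} (h : IsPullback a c f g) (hf : extensions.{v, u} C (n + 1) f)
    (hfW : comparisonIn W f) : comparisonIn W c := by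
  obtain ⟨hb, P, p₁, p₂, p, hp, hpW⟩ := hfW
  obtain ⟨R, r₁, r₂, r, z, hr, hz, -⟩ := exists_comparison_isPullback h hf hp
  exact ⟨MorphismProperty.of_isPullback (isPullback_botMap h hf) hb, R, r₁, r₂, r, hr,
    W.of_isPullback hz hpW⟩

end ComparisonIn

section Step

variable [IsExtensionClass (extensions.{v, u} C n)] {κ μ ν : NExt.{v, u} C (n + 1)}

lemma extensions_succ_comp {f : κ ⟶ μ} {g : μ ⟶ ν} (hf : extensions.{v, u} C (n + 1) f)
    (hg : extensions.{v, u} C (n + 1) g) : extensions.{v, u} C (n + 1) (f ≫ g) := by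
  rw [extensions_succ] at *
  exact comparisonIn_comp hf hg

lemma extensions_succ_of_precomp {f : κ ⟶ μ} {g : μ ⟶ ν} (hf : extensions.{v, u} C (n + 1) f)
    (hfg : extensions.{v, u} C (n + 1) (f ≫ g)) : extensions.{v, u} C (n + 1) g := by
  obtain ⟨hbf, P, p₁, p₂, p, hp, -⟩ := mem_succ_iff.1 hf
  obtain ⟨hbfg, hcomp⟩ := mem_succ_iff.1 hfg
  have hbg : extensions.{v, u} C n (botMap g) := MorphismProperty.of_precomp _ _ _ hbf hbfg
  obtain ⟨Q, q₁, q₂, hQ⟩ := exists_isPullback_of_mem hbg (arr ν)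
  have hq := isComparison_lift hQ (w g)
  obtain ⟨R, r₁, y, hR⟩ := exists_isPullback_of_mem hbf q₁
  obtain ⟨s, hs, hsq⟩ := hp.exists_comp hq hR
  refine mem_succ_iff.2 ⟨hbg, Q, q₁, q₂, _, hq,
    MorphismProperty.of_precomp _ _ _ (topMap_mem hf) ?_⟩
  rw [← hp.snd, Category.assoc, hsq.w, ← Category.assoc]
  exact MorphismProperty.comp_mem _ _ _ (hcomp.mem hs) (MorphismProperty.of_isPullback hR hbf)

lemma epi_of_mem_succ {f : κ ⟶ μ} (hf : extensions.{v, u} C (n + 1) f) : Epi f where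
  left_cancellation g h hgh := by
    have := IsExtensionClass.epi (topMap_mem hf)
    have := IsExtensionClass.epi (botMap_mem hf)
    refine hom_ext ?_ ?_
    · rw [← cancel_epi (topMap f), topMap_comm hgh]
    · rw [← cancel_epi (botMap f), botMap_comm hgh]

instance isExtensionClass_succ : IsExtensionClass (extensions.{v, u} C (n + 1)) where
  id_mem _ := by
    rw [extensions_succ]
    exact comparisonIn_of_isIso _
  comp_mem _ _ := extensions_succ_comp
  of_isPullback h hf := by
    have hf' := hf
    rw [extensions_succ] at hf ⊢
    exact comparisonIn_of_isPullback h hf' hf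
  hasPullback g hf := by
    obtain ⟨π, a, c, ht, hb⟩ := exists_isPullback_components hf g
    exact (isPullback_of_components ht hb).hasPullback
  of_precomp _ _ := extensions_succ_of_precomp
  isIso_of_isPullback h hg _ := isIso_of_components _
    (IsExtensionClass.isIso_of_isPullback (isPullback_topMap h.flip hg).flip (topMap_mem hg)
      inferInstance)
    (IsExtensionClass.isIso_of_isPullback (isPullback_botMap h.flip hg).flip (botMap_mem hg)
      inferInstance)
  epi := epi_of_mem_succ

end Step

instance isExtensionClass_extensions [Regular C] :
    ∀ n : ℕ, IsExtensionClass (extensions.{v, u} C n)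
  | 0 => isExtensionClass_regularEpi (C := C)
  | n + 1 => have := isExtensionClass_extensions n; isExtensionClass_succ

end NExt

/-! ### Trivial coverings and coverings -/

namespace GaloisStructure

variable {Y : Type u} [Category.{v} Y] {E : MorphismProperty Y} {Γ : GaloisStructure Y E}

lemma X_refl (Γ : GaloisStructure Y E) (A : Y) : Γ.X (Γ.refl A) := (Γ.L.obj A).property

lemma unit_naturality (Γ : GaloisStructure Y E) {A B : Y} (f : A ⟶ B) :
    Γ.unit A ≫ Γ.reflMap f = f ≫ Γ.unit B :=
  (Γ.adj.unit.naturality f).symm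

lemma reflMap_comp (Γ : GaloisStructure Y E) {A B D : Y} (f : A ⟶ B) (g : B ⟶ D) :
    Γ.reflMap (f ≫ g) = Γ.reflMap f ≫ Γ.reflMap g := by
  simp only [reflMap, Functor.map_comp]
  rfl

/-- `f : c ⟶ e` is a reflection of `c` in the reflective subcategory of `Γ`, not necessarily the
chosen unit. -/
def IsReflection (Γ : GaloisStructure Y E) {c e : Y} (f : c ⟶ e) : Prop :=
  Γ.X e ∧ ∀ ⦃b : Y⦄, Γ.X b → ∀ g : c ⟶ b, ∃! h : e ⟶ b, f ≫ h = g

lemma isReflection_unit (Γ : GaloisStructure Y E) (A : Y) : Γ.IsReflection (Γ.unit A) := by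
  refine ⟨Γ.X_refl A, fun b hb g => ?_⟩
  let e := Γ.adj.homEquiv A (⟨b, hb⟩ : Γ.X.FullSubcategory)
  have unit_comp : ∀ k : Γ.L.obj A ⟶ ⟨b, hb⟩, Γ.unit A ≫ Γ.X.ι.map k = e k := fun k =>
    (Γ.adj.homEquiv_unit _ _ k).symm
  refine ⟨Γ.X.ι.map (e.symm g), (unit_comp _).trans (e.apply_symm_apply g), fun h hh => ?_⟩
  have : e (ObjectProperty.homMk h) = g := (unit_comp _).symm.trans hh
  rw [← this, Equiv.symm_apply_apply]
  rfl

namespace IsReflection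

variable {b c e e' : Y} {f : c ⟶ e}

lemma hom_ext (hf : Γ.IsReflection f) (hb : Γ.X b) {h k : e ⟶ b} (hk : f ≫ h = f ≫ k) : h = k :=
  (hf.2 hb (f ≫ k)).unique hk rfl

lemma exists_iso {f' : c ⟶ e'} (hf : Γ.IsReflection f) (hf' : Γ.IsReflection f') :
    ∃ θ : e ≅ e', f ≫ θ.hom = f' := by
  obtain ⟨h, hh, -⟩ := hf.2 hf'.1 f'
  obtain ⟨k, hk, -⟩ := hf'.2 hf.1 f
  exact ⟨⟨h, k, hf.hom_ext hf.1 (by rw [reassoc_of% hh, hk, Category.comp_id]),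
    hf'.hom_ext hf'.1 (by rw [reassoc_of% hk, hh, Category.comp_id])⟩, hh⟩

lemma of_isIso (f : c ⟶ e) [IsIso f] (he : Γ.X e) : Γ.IsReflection f :=
  ⟨he, fun _ _ g => ⟨inv f ≫ g, by simp, fun h hh => by simp [← hh]⟩⟩

lemma isIso (hf : Γ.IsReflection f) (hc : Γ.X c) : IsIso f := by
  obtain ⟨θ, hθ⟩ := hf.exists_iso (of_isIso (𝟙 c) hc)
  rw [(Iso.comp_hom_eq_id θ).1 hθ]
  infer_instance

lemma iso_comp (hf : Γ.IsReflection f) (i : b ⟶ c) [IsIso i] : Γ.IsReflection (i ≫ f) :=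
  ⟨hf.1, fun _ hb g => by
    obtain ⟨h, hh, hu⟩ := hf.2 hb (inv i ≫ g)
    exact ⟨h, by simp only [Category.assoc, hh, IsIso.hom_inv_id_assoc],
      fun k hk => hu k (by simp only [← hk, Category.assoc, IsIso.inv_hom_id_assoc])⟩⟩

lemma mem [E.RespectsIso] (hf : Γ.IsReflection f) : E f := by
  obtain ⟨θ, hθ⟩ := (Γ.isReflection_unit c).exists_iso hf
  rw [← hθ]
  exact (MorphismProperty.cancel_right_of_respectsIso E _ _).2 (Γ.unit_mem c)

end IsReflection

lemma StronglyBirkhoff.reflMap_mem (hΓ : Γ.StronglyBirkhoff) {A B : Y} {f : A ⟶ B} (hf : E f) :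
    E (Γ.reflMap f) :=
  (hΓ f hf).cod

lemma StronglyBirkhoff.hasComparisonIn (hΓ : Γ.StronglyBirkhoff) {A B : Y} {f : A ⟶ B}
    (hf : E f) : HasComparisonIn E f (Γ.unit A) (Γ.unit B) (Γ.reflMap f) := by
  obtain ⟨P, π₁, π₂, p, hP, h₁, h₂, -, -, hp⟩ := (hΓ f hf).comparison
  exact ⟨P, π₁, π₂, p, ⟨hP, h₁, h₂⟩, hp⟩

section Reflections

variable {A B A' B' : Y} {f : A ⟶ B} {f' : A' ⟶ B'} {a : A ⟶ A'} {b : B ⟶ B'}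

lemma StronglyBirkhoff.mem_of_isReflection [E.RespectsIso] (hΓ : Γ.StronglyBirkhoff) (hf : E f)
    (ha : Γ.IsReflection a) (hb : Γ.IsReflection b) (h : a ≫ f' = f ≫ b) : E f' := by
  obtain ⟨θ, hθ⟩ := (Γ.isReflection_unit A).exists_iso ha
  obtain ⟨χ, hχ⟩ := (Γ.isReflection_unit B).exists_iso hb
  have : f' = θ.inv ≫ Γ.reflMap f ≫ χ.hom := by
    rw [Iso.eq_inv_comp]
    refine (Γ.isReflection_unit A).hom_ext hb.1 ?_
    rw [reassoc_of% unit_naturality, hχ, reassoc_of% hθ, h]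
  rw [this, MorphismProperty.cancel_left_of_respectsIso E,
    MorphismProperty.cancel_right_of_respectsIso E]
  exact hΓ.reflMap_mem hf

lemma IsTrivialCovering.isPullback (hf : Γ.IsTrivialCovering f) (ha : Γ.IsReflection a)
    (hb : Γ.IsReflection b) (h : a ≫ f' = f ≫ b) : IsPullback a f f' b := by
  obtain ⟨θ, hθ⟩ := (Γ.isReflection_unit A).exists_iso ha
  obtain ⟨χ, hχ⟩ := (Γ.isReflection_unit B).exists_iso hb
  refine hf.2.of_iso (Iso.refl _) θ (Iso.refl _) χ (by simp [hθ]) (by simp) ?_ (by simp [hχ])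
  refine (Γ.isReflection_unit A).hom_ext hb.1 ?_
  rw [reassoc_of% unit_naturality, hχ, reassoc_of% hθ, h]

end Reflections

section Coverings

variable [IsExtensionClass E] {A B D A' B' : Y}

lemma IsTrivialCovering.isCovering {f : A ⟶ B} (hf : Γ.IsTrivialCovering f) : Γ.IsCovering f :=
  ⟨hf.1, B, 𝟙 B, E.id_mem B, A, f, 𝟙 A, IsPullback.of_horiz_isIso ⟨by simp⟩, hf⟩

lemma IsCovering.of_isPullback_of_mem {f : A ⟶ B} {f' : A' ⟶ B'} {a : A' ⟶ A} {b : B' ⟶ B}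
    (h : IsPullback a f' f b) (hf : E f) (hb : E b) (hf' : Γ.IsCovering f') :
    Γ.IsCovering f := by
  obtain ⟨-, S, e, he, P, t, x, hP, ht⟩ := hf'
  exact ⟨hf, S, e ≫ b, E.comp_mem _ _ he hb, P, t, x ≫ a, hP.paste_horiz h, ht⟩

section StronglyBirkhoff

variable (hΓ : Γ.StronglyBirkhoff)
include hΓ

/-- The comparison map of the reflection square is an extension and monic, hence invertible. -/
lemma StronglyBirkhoff.isTrivialCovering_of_jointly_mono {S X : Y} {t : A ⟶ S} (ht : E t)
    (x : A ⟶ X) (hX : Γ.X X)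
    (hm : ∀ {R : Y} (a b : R ⟶ A), a ≫ t = b ≫ t → a ≫ x = b ≫ x → a = b) :
    Γ.IsTrivialCovering t := by
  obtain ⟨P, π₁, π₂, p, ⟨hP, h₁, h₂⟩, hp⟩ := hΓ.hasComparisonIn ht
  obtain ⟨y, hy, -⟩ := (Γ.isReflection_unit A).2 hX x
  have : Mono p := ⟨fun a b hab => hm a b
    (by rw [← h₁, reassoc_of% hab]) (by rw [← hy, ← h₂, Category.assoc, reassoc_of% hab])⟩
  have : IsIso p := isIso_of_mem_of_mono hp
  exact ⟨ht, (hP.of_iso' (asIso p) (Iso.refl _) (Iso.refl _) (Iso.refl _) (by simp [h₁])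
    (by simp [h₂]) (by simp) (by simp)).flip⟩

lemma StronglyBirkhoff.isTrivialCovering_of_mem {f : A ⟶ B} (hf : E f) (hA : Γ.X A) :
    Γ.IsTrivialCovering f :=
  hΓ.isTrivialCovering_of_jointly_mono hf (𝟙 A) hA fun a b _ h => by simpa using h

lemma StronglyBirkhoff.isTrivialCovering_of_isIso (f : A ⟶ B) [IsIso f] :
    Γ.IsTrivialCovering f :=
  hΓ.isTrivialCovering_of_jointly_mono (E.of_isIso f) (Γ.unit A) (Γ.X_refl A)
    fun _ _ h _ => (cancel_mono f).1 h

namespace IsTrivialCovering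

lemma of_isPullback {f : A ⟶ B} {f' : A' ⟶ B'} {a : A' ⟶ A} {b : B' ⟶ B}
    (h : IsPullback a f' f b) (hf : Γ.IsTrivialCovering f) : Γ.IsTrivialCovering f' :=
  hΓ.isTrivialCovering_of_jointly_mono (MorphismProperty.of_isPullback h hf.1)
    (a ≫ Γ.unit A) (Γ.X_refl A) fun x y h₁ h₂ => h.hom_ext (hf.2.hom_ext (by simpa using h₂)
      (by rw [Category.assoc, Category.assoc, h.w, reassoc_of% h₁])) h₁

lemma comp {f : A ⟶ B} {g : B ⟶ D} (hf : Γ.IsTrivialCovering f) (hg : Γ.IsTrivialCovering g) :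
    Γ.IsTrivialCovering (f ≫ g) :=
  hΓ.isTrivialCovering_of_jointly_mono (E.comp_mem _ _ hf.1 hg.1) (Γ.unit A) (Γ.X_refl A)
    fun x y h₁ h₂ => hf.2.hom_ext h₂ (hg.2.hom_ext
      (by rw [Category.assoc, Category.assoc, ← unit_naturality, reassoc_of% h₂])
      (by simpa using h₁))

/-- The comparison `j` of the reflection square of `g` becomes invertible when pulled back along
an extension, because the reflection squares of `f` and of `f ≫ g` are pullbacks. -/
lemma of_comp {f : A ⟶ B} {g : B ⟶ D} (hf : Γ.IsTrivialCovering f)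
    (hfg : Γ.IsTrivialCovering (f ≫ g)) : Γ.IsTrivialCovering g := by
  have hg : E g := MorphismProperty.of_precomp _ _ _ hf.1 hfg.1
  obtain ⟨Q, q₁, q₂, hQ⟩ := exists_isPullback_of_mem (hΓ.reflMap_mem hg) (Γ.unit D)
  let j : B ⟶ Q := hQ.lift (Γ.unit B) g (Γ.unit_naturality g)
  obtain ⟨W, w₁, w₂, hW⟩ := exists_isPullback_of_mem (hΓ.reflMap_mem hf.1) q₁
  let k : A ⟶ W := hW.lift (Γ.unit A) (f ≫ j) (by
    rw [unit_naturality, Category.assoc, hQ.lift_fst])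
  have pullback_of_j : IsPullback k f w₂ j := by
    refine IsPullback.of_right (h₁₂ := w₁) (v₁₃ := Γ.reflMap f) (h₂₂ := q₁) ?_
      (hW.lift_snd _ _ _) hW
    rw [hW.lift_fst, hQ.lift_fst]
    exact hf.2
  have pullback_comp : IsPullback w₁ (w₂ ≫ q₂) (Γ.reflMap (f ≫ g)) (Γ.unit D) := by
    rw [reflMap_comp]
    exact hW.paste_vert hQ
  have : k = (hfg.2.isoIsPullback _ _ pullback_comp).hom := by
    apply pullback_comp.hom_ext
    · rw [hW.lift_fst, IsPullback.isoIsPullback_hom_fst]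
    · rw [hW.lift_snd_assoc, Category.assoc, hQ.lift_snd, IsPullback.isoIsPullback_hom_snd]
  have : IsIso k := by
    rw [this]
    infer_instance
  have : IsIso j := IsExtensionClass.isIso_of_isPullback pullback_of_j.flip
    (MorphismProperty.of_isPullback hW (hΓ.reflMap_mem hf.1)) this
  exact ⟨hg, hQ.of_iso' (asIso j) (Iso.refl _) (Iso.refl _) (Iso.refl _)
    (by simpa using hQ.lift_fst _ _ _) (by simpa using hQ.lift_snd _ _ _) (by simp) (by simp)⟩

end IsTrivialCovering

lemma IsCovering.of_isPullback {f : A ⟶ B} {f' : A' ⟶ B'} {a : A' ⟶ A} {b : B' ⟶ B}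
    (h : IsPullback a f' f b) (hf : Γ.IsCovering f) : Γ.IsCovering f' := by
  obtain ⟨hf₀, S, e, he, P, t, x, hP, ht⟩ := hf
  have hf' : E f' := MorphismProperty.of_isPullback h hf₀
  obtain ⟨S', s₁, s₂, hS⟩ := exists_isPullback_of_mem he b
  obtain ⟨P', x', t', hP'⟩ := exists_isPullback_of_mem hf' s₂
  refine ⟨hf', S', s₂, MorphismProperty.of_isPullback hS he, P', t', x', hP', ?_⟩
  have : IsPullback (x' ≫ a) t' f (s₁ ≫ e) := by
    rw [hS.w]
    exact hP'.paste_horiz h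
  exact ht.of_isPullback hΓ (IsPullback.of_right' this hP)

lemma IsTrivialCovering.comp_isCovering {f : A ⟶ B} {g : B ⟶ D} (hf : Γ.IsTrivialCovering f)
    (hg : Γ.IsCovering g) : Γ.IsCovering (f ≫ g) := by
  obtain ⟨hg₀, S, e, he, P, t, x, hP, ht⟩ := hg
  obtain ⟨Q, q₁, q₂, hQ⟩ := exists_isPullback_of_mem hf.1 x
  exact ⟨E.comp_mem _ _ hf.1 hg₀, S, e, he, Q, q₂ ≫ t, q₁, hQ.paste_vert hP,
    (hf.of_isPullback hΓ hQ).comp hΓ ht⟩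

lemma IsTrivialCovering.isCovering_of_comp {f : A ⟶ B} {g : B ⟶ D} (hf : Γ.IsTrivialCovering f)
    (hfg : Γ.IsCovering (f ≫ g)) : Γ.IsCovering g := by
  obtain ⟨hfg₀, S, e, he, P, t, x, hP, ht⟩ := hfg
  have hg : E g := MorphismProperty.of_precomp _ _ _ hf.1 hfg₀
  obtain ⟨Q, q₁, q₂, hQ⟩ := exists_isPullback_of_mem hg e
  refine ⟨hg, S, e, he, Q, q₂, q₁, hQ, ?_⟩
  have : IsPullback x (hQ.lift (x ≫ f) t (by rw [Category.assoc, hP.w])) f q₁ :=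
    IsPullback.of_bot' hP hQ
  refine (hf.of_isPullback hΓ this).of_comp hΓ ?_
  rwa [hQ.lift_snd]

end StronglyBirkhoff

end Coverings

end GaloisStructure

/-! ### Discrete fibrations, inductively -/

namespace NExt

variable {C : Type (max u v)} [Category.{v} C]

variable (C) in
/-- The class of discrete fibrations of order `n + 1`, described inductively through comparison
morphisms rather than through limit cubes; see `isDiscreteFibration_iff_discFib`. -/
def discFib : ∀ n : ℕ, MorphismProperty (NExt.{v, u} C n)
  | 0 => MorphismProperty.isomorphisms (NExt.{v, u} C 0)
  | n + 1 => comparisonIn (discFib n)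

variable [Regular C]

lemma discFib_le_extensions : ∀ n : ℕ, discFib.{v, u} C n ≤ extensions.{v, u} C n
  | 0 => fun _ _ f (_ : IsIso f) => (extensions.{v, u} C 0).of_isIso f
  | n + 1 => by
    rw [extensions_succ]
    exact comparisonIn_mono (discFib_le_extensions n)

instance isStableUnderBaseChange_discFib :
    ∀ n : ℕ, (discFib.{v, u} C n).IsStableUnderBaseChange
  | 0 => inferInstanceAs
      (MorphismProperty.isomorphisms (NExt.{v, u} C 0)).IsStableUnderBaseChange
  | n + 1 =>
    have := isStableUnderBaseChange_discFib n
    ⟨fun h hf => comparisonIn_of_isPullback h (discFib_le_extensions (n + 1) _ hf) hf⟩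

instance isMultiplicative_discFib : ∀ n : ℕ, (discFib.{v, u} C n).IsMultiplicative
  | 0 => inferInstanceAs (MorphismProperty.isomorphisms (NExt.{v, u} C 0)).IsMultiplicative
  | n + 1 =>
    have := isMultiplicative_discFib n
    { id_mem _ := comparisonIn_of_isIso _
      comp_mem _ _ := comparisonIn_comp }

lemma exists_isComparison {n : ℕ} {κ μ : NExt.{v, u} C (n + 1)} {f : κ ⟶ μ}
    (hf : extensions.{v, u} C (n + 1) f) :
    ∃ (P : NExt.{v, u} C n) (p₁ : P ⟶ bot κ) (p₂ : P ⟶ top μ) (p : top κ ⟶ P),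
      IsComparison (arr κ) (topMap f) (botMap f) (arr μ) p₁ p₂ p ∧ extensions.{v, u} C n p :=
  (mem_succ_iff.1 hf).2

/-- Unlike in a category with all pullbacks, `f` has to be known to be an extension. -/
lemma discFib_of_postcomp : ∀ {n : ℕ} {κ μ ν : NExt.{v, u} C n} {f : κ ⟶ μ} {g : μ ⟶ ν},
    extensions.{v, u} C n f → discFib.{v, u} C n g → discFib.{v, u} C n (f ≫ g) →
      discFib.{v, u} C n f
  | 0, _, _, _, f, g, _, (_ : IsIso g), (_ : IsIso (f ≫ g)) => IsIso.of_isIso_comp_right f g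
  | n + 1, _, _, _, f, g, hf, ⟨_, Q, q₁, q₂, q, hq, hqD⟩, hfg => by
    obtain ⟨P, p₁, p₂, p, hp, hpE⟩ := exists_isComparison hf
    obtain ⟨R, r₁, y, hR⟩ := exists_isPullback_of_mem (botMap_mem hf) q₁
    obtain ⟨s, hs, hsq⟩ := hp.exists_comp hq hR
    exact ⟨botMap_mem hf, P, p₁, p₂, p, hp, discFib_of_postcomp hpE
      (MorphismProperty.of_isPullback hsq hqD) (hfg.2.mem hs)⟩

lemma discFib_of_isPullback_of_mem : ∀ {n : ℕ} {κ μ ν π : NExt.{v, u} C n} {a : π ⟶ κ} {b : π ⟶ ν}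
    {f : κ ⟶ μ} {g : ν ⟶ μ}, IsPullback a b f g → extensions.{v, u} C n g →
      extensions.{v, u} C n f → discFib.{v, u} C n b → discFib.{v, u} C n f
  | 0, _, _, _, _, _, _, _, _, h, hg, _, hb => IsExtensionClass.isIso_of_isPullback h hg hb
  | n + 1, _, _, _, _, _, _, _, _, h, hg, hf, hb => by
    obtain ⟨P, p₁, p₂, p, hp, hpE⟩ := exists_isComparison hf
    obtain ⟨R, r₁, r₂, r, z, hr, hz, hz'⟩ := exists_comparison_isPullback h hf hp
    exact ⟨botMap_mem hf, P, p₁, p₂, p, hp, discFib_of_isPullback_of_mem hz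
      (MorphismProperty.of_isPullback hz'.flip (topMap_mem hg)) hpE (hb.2.mem hr)⟩

lemma discFib_of_components {n : ℕ} {κ μ : NExt.{v, u} C (n + 1)} {f : κ ⟶ μ}
    (hf : extensions.{v, u} C (n + 1) f) (ht : discFib.{v, u} C n (topMap f))
    (hb : discFib.{v, u} C n (botMap f)) : discFib.{v, u} C (n + 1) f := by
  obtain ⟨P, p₁, p₂, p, hp, hpE⟩ := exists_isComparison hf
  exact ⟨botMap_mem hf, P, p₁, p₂, p, hp,
    discFib_of_postcomp hpE (MorphismProperty.of_isPullback hp.isPullback hb) (by rwa [hp.snd])⟩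

end NExt

/-! ### Reflections in a tower of Galois structures -/

namespace GaloisTower

open NExt GaloisStructure

variable {C : Type (max u v)} [Category.{v} C]

lemma X_succ_iff (T : GaloisTower.{v, u} C) {n : ℕ} (κ : NExt.{v, u} C (n + 1)) :
    (T.Γ (n + 1)).X κ ↔ (T.Γ n).IsCovering (arr κ) :=
  T.mem_succ_iff n κ

variable {T : GaloisTower.{v, u} C} [Regular C] {n : ℕ}

/-- The reflection of `κ` factors the morphism from `κ` to the covering `𝟙 (bot κ)`. -/
lemma isIso_botMap_of_isReflection {κ μ : NExt.{v, u} C (n + 1)} {f : κ ⟶ μ}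
    (hf : (T.Γ (n + 1)).IsReflection f) : IsIso (botMap f) := by
  let ι : NExt.{v, u} C (n + 1) := ofHom.{v, u} (𝟙 (bot κ)) ((extensions.{v, u} C n).id_mem _)
  have hι : (T.Γ (n + 1)).X ι := (T.X_succ_iff ι).2
    ((T.stronglyBirkhoff n).isTrivialCovering_of_isIso (𝟙 (bot κ))).isCovering
  obtain ⟨h, hh, -⟩ := hf.2 hι (homMk (μ := ι) (arr κ) (𝟙 (bot κ)) rfl)
  have hfh : botMap f ≫ botMap (μ := ι) h = 𝟙 (bot κ) := congrArg (botMap (μ := ι)) hh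
  have : IsSplitMono (botMap f) := ⟨⟨⟨botMap (μ := ι) h, hfh⟩⟩⟩
  exact isIso_of_mem_of_mono (botMap_mem hf.mem)

/-- The reflection of `κ` factors the morphism from `κ` to the pullback of the reflection of
`arr κ` along the unit at `bot κ`, which is a trivial covering. -/
lemma exists_topMap_comp_eq {κ μ : NExt.{v, u} C (n + 1)} {f : κ ⟶ μ}
    (hf : (T.Γ (n + 1)).IsReflection f) {b : NExt.{v, u} C n} (hb : (T.Γ n).X b)
    (g : top κ ⟶ b) : ∃ h : top μ ⟶ b, topMap f ≫ h = g := by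
  have hΓ := T.stronglyBirkhoff n
  have hr := hΓ.reflMap_mem (arr_mem κ)
  obtain ⟨Z, z₁, z₂, hZ⟩ := exists_isPullback_of_mem hr ((T.Γ n).unit (bot κ))
  have hz : (T.Γ n).IsTrivialCovering z₂ :=
    (hΓ.isTrivialCovering_of_mem hr ((T.Γ n).X_refl _)).of_isPullback hΓ hZ
  let ζ : NExt.{v, u} C (n + 1) := ofHom.{v, u} z₂ hz.1
  have hζ : (T.Γ (n + 1)).X ζ := (T.X_succ_iff ζ).2 hz.isCovering
  let l : top κ ⟶ Z := hZ.lift ((T.Γ n).unit _) (arr κ) (unit_naturality _ _)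
  obtain ⟨h, hh, -⟩ := hf.2 hζ (homMk (μ := ζ) l (𝟙 (bot κ))
    ((hZ.lift_snd _ _ _).trans (Category.comp_id _).symm))
  obtain ⟨g', hg', -⟩ := ((T.Γ n).isReflection_unit (top κ)).2 hb g
  let h' : top μ ⟶ Z := topMap (μ := ζ) h
  have hl : topMap f ≫ h' = l := congrArg (topMap (μ := ζ)) hh
  exact ⟨h' ≫ z₁ ≫ g', by rw [reassoc_of% hl, hZ.lift_fst_assoc, hg']⟩

lemma isTrivialCovering_of_discFib (T : GaloisTower.{v, u} C) :
    ∀ {n : ℕ} {κ μ : NExt.{v, u} C n} {f : κ ⟶ μ}, discFib.{v, u} C n f →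
      (T.Γ n).IsTrivialCovering f
  | 0, _, _, f, (_ : IsIso f) => (T.stronglyBirkhoff 0).isTrivialCovering_of_isIso f
  | n + 1, κ, μ, f, hf => by
    obtain ⟨-, P, p₁, p₂, p, hp, hpD⟩ := id hf
    have hu := (T.Γ (n + 1)).isReflection_unit κ
    refine (T.stronglyBirkhoff _).isTrivialCovering_of_jointly_mono
      (discFib_le_extensions _ _ hf) ((T.Γ (n + 1)).unit κ) ((T.Γ (n + 1)).X_refl κ)
      fun a b h₁ h₂ => ?_
    have hb : botMap a = botMap b := by
      have := isIso_botMap_of_isReflection hu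
      rw [← cancel_mono (botMap ((T.Γ (n + 1)).unit κ))]
      exact botMap_comm h₂
    refine hom_ext ((isTrivialCovering_of_discFib T hpD).2.hom_ext ?_
      (hp.isPullback.hom_ext ?_ ?_)) hb
    · obtain ⟨h, hh⟩ := exists_topMap_comp_eq hu ((T.Γ n).X_refl _) ((T.Γ n).unit (top κ))
      rw [← hh, ← Category.assoc, ← Category.assoc]
      exact congrArg (· ≫ h) (topMap_comm h₂)
    · rw [Category.assoc, Category.assoc, hp.fst, w, w, hb]
    · rw [Category.assoc, Category.assoc, hp.snd]
      exact topMap_comm h₁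

lemma isCovering_iff_of_discFib {κ μ : NExt.{v, u} C (n + 1)} {f : κ ⟶ μ}
    (hf : discFib.{v, u} C (n + 1) f) : T.IsCovering κ ↔ T.IsCovering μ := by
  have hΓ := T.stronglyBirkhoff n
  obtain ⟨hb, P, p₁, p₂, p, hp, hpD⟩ := hf
  have ht := T.isTrivialCovering_of_discFib hpD
  change (T.Γ n).IsCovering (arr κ) ↔ (T.Γ n).IsCovering (arr μ)
  rw [← hp.fst]
  constructor
  · intro h
    exact (ht.isCovering_of_comp hΓ h).of_isPullback_of_mem hp.isPullback.flip (arr_mem μ) hb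
  · intro h
    exact ht.comp_isCovering hΓ (h.of_isPullback hΓ hp.isPullback.flip)

end GaloisTower

namespace NExt

variable {C : Type (max u v)} [Category.{v} C]

/-! ### Conditions on the faces of a cube -/

section Faces

/-- The property of a morphism of `n`-fold extensions that its restrictions to all the faces
obtained by fixing the first `i` coordinates have the property `Q`. If `n < i`, then all
coordinates are fixed. -/
def onFaces (Q : ∀ n, MorphismProperty (NExt.{v, u} C n)) :
    ℕ → ∀ n, MorphismProperty (NExt.{v, u} C n)
  | 0, n => Q n
  | _ + 1, 0 => Q 0
  | i + 1, n + 1 => fun _ _ f => onFaces Q i n (topMap f) ∧ onFaces Q i n (botMap f)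

/-- The property of an `n`-fold extension that all the faces obtained by fixing the first `i`
coordinates have the property `P`. If `n < i`, then all coordinates are fixed. -/
def FacesSatisfy (P : ∀ n, ObjectProperty (NExt.{v, u} C n)) :
    ℕ → ∀ n, ObjectProperty (NExt.{v, u} C n)
  | 0, n => P n
  | _ + 1, 0 => P 0
  | i + 1, n + 1 => fun κ => FacesSatisfy P i n (top κ) ∧ FacesSatisfy P i n (bot κ)

variable {Q Q' : ∀ n, MorphismProperty (NExt.{v, u} C n)}
  {P P' : ∀ n, ObjectProperty (NExt.{v, u} C n)}

lemma onFaces_of_isIso [∀ n, (Q n).ContainsIdentities] [∀ n, (Q n).RespectsIso] :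
    ∀ {i n : ℕ} {κ μ : NExt.{v, u} C n} (f : κ ⟶ μ) [IsIso f], onFaces Q i n f
  | 0, n, _, _, f, _ => (Q n).of_isIso f
  | _ + 1, 0, _, _, f, _ => (Q 0).of_isIso f
  | _ + 1, _ + 1, _, _, f, _ => ⟨onFaces_of_isIso (topMap f), onFaces_of_isIso (botMap f)⟩

lemma onFaces_comp [∀ n, (Q n).IsStableUnderComposition] :
    ∀ {i n : ℕ} {κ μ ν : NExt.{v, u} C n} {f : κ ⟶ μ} {g : μ ⟶ ν},
      onFaces Q i n f → onFaces Q i n g → onFaces Q i n (f ≫ g)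
  | 0, n, _, _, _, _, _, hf, hg => (Q n).comp_mem _ _ hf hg
  | _ + 1, 0, _, _, _, _, _, hf, hg => (Q 0).comp_mem _ _ hf hg
  | _ + 1, _ + 1, _, _, _, _, _, hf, hg => ⟨onFaces_comp hf.1 hg.1, onFaces_comp hf.2 hg.2⟩

lemma onFaces_of_postcomp [∀ n, (Q n).HasOfPostcompProperty (Q n)] :
    ∀ {i n : ℕ} {κ μ ν : NExt.{v, u} C n} {f : κ ⟶ μ} {g : μ ⟶ ν},
      onFaces Q i n g → onFaces Q i n (f ≫ g) → onFaces Q i n f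
  | 0, n, _, _, _, _, _, hg, hfg => MorphismProperty.of_postcomp (Q n) (W' := Q n) _ _ hg hfg
  | _ + 1, 0, _, _, _, _, _, hg, hfg => MorphismProperty.of_postcomp (Q 0) (W' := Q 0) _ _ hg hfg
  | _ + 1, _ + 1, _, _, _, _, _, hg, hfg =>
    ⟨onFaces_of_postcomp hg.1 hfg.1, onFaces_of_postcomp hg.2 hfg.2⟩

lemma onFaces_of_isPullback [Regular C]
    (hQ : ∀ {n} {κ μ ν π : NExt.{v, u} C n} {a : π ⟶ κ} {b : π ⟶ ν} {f : κ ⟶ μ} {g : ν ⟶ μ},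
      IsPullback a b f g → extensions.{v, u} C n f → Q n f → Q n b) :
    ∀ {i n : ℕ} {κ μ ν π : NExt.{v, u} C n} {a : π ⟶ κ} {b : π ⟶ ν} {f : κ ⟶ μ} {g : ν ⟶ μ},
      IsPullback a b f g → extensions.{v, u} C n f → onFaces Q i n f → onFaces Q i n b
  | 0, _, _, _, _, _, _, _, _, _, h, hf, hfQ => hQ h hf hfQ
  | _ + 1, 0, _, _, _, _, _, _, _, _, h, hf, hfQ => hQ h hf hfQ
  | _ + 1, _ + 1, _, _, _, _, _, _, _, _, h, hf, hfQ =>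
    ⟨onFaces_of_isPullback hQ (isPullback_topMap h hf) (topMap_mem hf) hfQ.1,
      onFaces_of_isPullback hQ (isPullback_botMap h hf) (botMap_mem hf) hfQ.2⟩

lemma onFaces_mono
    (hQ : ∀ {n} {κ μ : NExt.{v, u} C n} {f : κ ⟶ μ}, extensions.{v, u} C n f → Q n f → Q' n f) :
    ∀ {i n : ℕ} {κ μ : NExt.{v, u} C n} {f : κ ⟶ μ},
      extensions.{v, u} C n f → onFaces Q i n f → onFaces Q' i n f
  | 0, _, _, _, _, hf, h => hQ hf h
  | _ + 1, 0, _, _, _, hf, h => hQ hf h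
  | _ + 1, _ + 1, _, _, _, hf, h =>
    ⟨onFaces_mono hQ (topMap_mem hf) h.1, onFaces_mono hQ (botMap_mem hf) h.2⟩

lemma FacesSatisfy.of_onFaces (hQ : ∀ {n} {κ μ : NExt.{v, u} C n} {f : κ ⟶ μ}, Q n f → P n μ) :
    ∀ {i n : ℕ} {κ μ : NExt.{v, u} C n} {f : κ ⟶ μ}, onFaces Q i n f → FacesSatisfy P i n μ
  | 0, _, _, _, _, hf => hQ hf
  | _ + 1, 0, _, _, _, hf => hQ hf
  | _ + 1, _ + 1, _, _, _, hf => ⟨of_onFaces hQ hf.1, of_onFaces hQ hf.2⟩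

lemma FacesSatisfy.dom_of_onFaces
    (hQ : ∀ {n} {κ μ : NExt.{v, u} C n} {f : κ ⟶ μ}, Q n f → P n μ → P' n κ) :
    ∀ {i n : ℕ} {κ μ : NExt.{v, u} C n} {f : κ ⟶ μ},
      onFaces Q i n f → FacesSatisfy P i n μ → FacesSatisfy P' i n κ
  | 0, _, _, _, _, hf, h => hQ hf h
  | _ + 1, 0, _, _, _, hf, h => hQ hf h
  | _ + 1, _ + 1, _, _, _, hf, h => ⟨dom_of_onFaces hQ hf.1 h.1, dom_of_onFaces hQ hf.2 h.2⟩

lemma FacesSatisfy.cod_of_onFaces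
    (hQ : ∀ {n} {κ μ : NExt.{v, u} C n} {f : κ ⟶ μ}, Q n f → P n κ → P' n μ) :
    ∀ {i n : ℕ} {κ μ : NExt.{v, u} C n} {f : κ ⟶ μ},
      onFaces Q i n f → FacesSatisfy P i n κ → FacesSatisfy P' i n μ
  | 0, _, _, _, _, hf, h => hQ hf h
  | _ + 1, 0, _, _, _, hf, h => hQ hf h
  | _ + 1, _ + 1, _, _, _, hf, h => ⟨cod_of_onFaces hQ hf.1 h.1, cod_of_onFaces hQ hf.2 h.2⟩

variable [Regular C]

lemma discFib_of_onFaces : ∀ {i n : ℕ} {κ μ : NExt.{v, u} C n} {f : κ ⟶ μ},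
    extensions.{v, u} C n f → onFaces (discFib.{v, u} C) i n f → discFib.{v, u} C n f
  | 0, _, _, _, _, _, h => h
  | _ + 1, 0, _, _, _, _, h => h
  | _ + 1, _ + 1, _, _, _, hf, h => discFib_of_components hf
      (discFib_of_onFaces (topMap_mem hf) h.1) (discFib_of_onFaces (botMap_mem hf) h.2)

lemma onFaces_discFib_of_succ : ∀ {i n : ℕ} {κ μ : NExt.{v, u} C n} {f : κ ⟶ μ},
    extensions.{v, u} C n f → onFaces (discFib.{v, u} C) (i + 1) n f →
      onFaces (discFib.{v, u} C) i n f
  | 0, _, _, _, _, hf, h => discFib_of_onFaces hf h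
  | _ + 1, 0, _, _, _, _, h => h
  | _ + 1, _ + 1, _, _, _, hf, h =>
    ⟨onFaces_discFib_of_succ (topMap_mem hf) h.1, onFaces_discFib_of_succ (botMap_mem hf) h.2⟩

end Faces

/-! ### Cartesian morphisms -/

section Cartesian

variable (C) in
/-- The morphisms of multiple extensions which are pullback squares. At level `0` these are the
isomorphisms. -/
def cartesian : ∀ n : ℕ, MorphismProperty (NExt.{v, u} C n)
  | 0 => MorphismProperty.isomorphisms (NExt.{v, u} C 0)
  | _ + 1 => fun κ μ f => IsPullback (topMap f) (arr κ) (arr μ) (botMap f)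

instance isStableUnderComposition_cartesian :
    ∀ n : ℕ, (cartesian.{v, u} C n).IsStableUnderComposition
  | 0 => inferInstanceAs
      (MorphismProperty.isomorphisms (NExt.{v, u} C 0)).IsStableUnderComposition
  | _ + 1 => ⟨fun _ _ hf hg => IsPullback.paste_horiz hf hg⟩

instance hasOfPostcompProperty_cartesian :
    ∀ n : ℕ, (cartesian.{v, u} C n).HasOfPostcompProperty (cartesian.{v, u} C n)
  | 0 => ⟨fun f g (_ : IsIso g) (_ : IsIso (f ≫ g)) => IsIso.of_isIso_comp_right f g⟩
  | _ + 1 => ⟨fun f _ hg hfg => IsPullback.of_right hfg (w f) hg⟩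

variable [Regular C]

lemma cartesian_of_isPullback : ∀ {n : ℕ} {κ μ ν π : NExt.{v, u} C n} {a : π ⟶ κ} {b : π ⟶ ν}
    {f : κ ⟶ μ} {g : ν ⟶ μ}, IsPullback a b f g → extensions.{v, u} C n f →
      cartesian.{v, u} C n f → cartesian.{v, u} C n b
  | 0, _, _, _, _, _, _, _, _, h, _, hc => by
    have : IsIso _ := hc
    exact h.isIso_snd_of_isIso
  | n + 1, κ, _, ν, π, a, b, f, g, h, hf, hc => by
    have hp : IsPullback (topMap a ≫ arr κ) (topMap b) (botMap f) (topMap g ≫ arr _) :=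
      (isPullback_topMap h hf).paste_horiz (IsPullback.flip hc)
    rw [w, w] at hp
    exact (IsPullback.of_right hp (w b).symm (isPullback_botMap h hf)).flip

lemma mem_of_cartesian {n : ℕ} {κ μ : NExt.{v, u} C (n + 1)} {f : κ ⟶ μ}
    (hf : cartesian.{v, u} C (n + 1) f) (hb : extensions.{v, u} C n (botMap f)) :
    extensions.{v, u} C (n + 1) f :=
  mem_succ_iff.2 ⟨hb, _, _, _, _, isComparison_id_of_isPullback (IsPullback.flip hf),
    (extensions.{v, u} C n).id_mem _⟩

lemma discFib_of_cartesian : ∀ {n : ℕ} {κ μ : NExt.{v, u} C n} {f : κ ⟶ μ},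
    extensions.{v, u} C n f → cartesian.{v, u} C n f → discFib.{v, u} C n f
  | 0, _, _, _, _, h => h
  | n + 1, _, _, _, hf, h => ⟨botMap_mem hf, _, _, _, _,
      isComparison_id_of_isPullback (IsPullback.flip h), (discFib.{v, u} C n).id_mem _⟩

variable {i n : ℕ}

lemma onFaces_discFib_of_cartesian {κ μ : NExt.{v, u} C n} {f : κ ⟶ μ}
    (hf : extensions.{v, u} C n f) (h : onFaces (cartesian.{v, u} C) i n f) :
    onFaces (discFib.{v, u} C) i n f :=
  onFaces_mono discFib_of_cartesian hf h

variable {β β' τ ν P : NExt.{v, u} C n} {b : β ⟶ β'} {m : ν ⟶ β'} {p₁ : P ⟶ β} {p₂ : P ⟶ ν}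
  {k : τ ⟶ P}

lemma onFaces_cartesian_comp_snd (hP : IsPullback p₁ p₂ b m) (hb : extensions.{v, u} C n b)
    (hcb : onFaces (cartesian.{v, u} C) i n b) (hck : onFaces (cartesian.{v, u} C) i n k) :
    onFaces (cartesian.{v, u} C) i n (k ≫ p₂) :=
  onFaces_comp hck (onFaces_of_isPullback cartesian_of_isPullback hP hb hcb)

lemma onFaces_cartesian_of_isComparison {t : τ ⟶ ν} {l : τ ⟶ β}
    (hk : IsComparison l t b m p₁ p₂ k) (hb : extensions.{v, u} C n b)
    (hcb : onFaces (cartesian.{v, u} C) i n b) (hct : onFaces (cartesian.{v, u} C) i n t) :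
    onFaces (cartesian.{v, u} C) i n k :=
  onFaces_of_postcomp (onFaces_of_isPullback cartesian_of_isPullback hk.isPullback hb hcb)
    (by rwa [hk.snd])

end Cartesian

/-! ### Restriction to a face -/

/-- A functor between categories of multiple extensions which preserves extensions and pullbacks of
extensions. -/
structure ExtFunctor (C : Type (max u v)) [Category.{v} C] (m n : ℕ) where
  /-- the underlying functor -/
  F : NExt.{v, u} C m ⥤ NExt.{v, u} C n
  mem : ∀ {κ μ : NExt.{v, u} C m} {f : κ ⟶ μ},
    extensions.{v, u} C m f → extensions.{v, u} C n (F.map f)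
  isPullback : ∀ {κ μ ν π : NExt.{v, u} C m} {a : π ⟶ κ} {b : π ⟶ ν} {f : κ ⟶ μ} {g : ν ⟶ μ},
    IsPullback a b f g → extensions.{v, u} C m f →
      IsPullback (F.map a) (F.map b) (F.map f) (F.map g)

lemma ExtFunctor.isComparison {m n : ℕ} (G : ExtFunctor.{v, u} C m n)
    {A A' B B' P : NExt.{v, u} C m} {k : A ⟶ B} {t : A ⟶ A'} {b : B ⟶ B'} {l : A' ⟶ B'}
    {π₁ : P ⟶ B} {π₂ : P ⟶ A'} {p : A ⟶ P} (hp : IsComparison k t b l π₁ π₂ p)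
    (hb : extensions.{v, u} C m b) :
    IsComparison (G.F.map k) (G.F.map t) (G.F.map b) (G.F.map l) (G.F.map π₁) (G.F.map π₂)
      (G.F.map p) :=
  ⟨G.isPullback hp.isPullback hb, by rw [← Functor.map_comp, hp.fst],
    by rw [← Functor.map_comp, hp.snd]⟩

variable [Regular C]

/-- The functor between categories of multiple extensions obtained by applying a functor to the
domain and the codomain of an arrow. -/
def ExtFunctor.lift {m n : ℕ} (G : ExtFunctor.{v, u} C m n) :
    ExtFunctor.{v, u} C (m + 1) (n + 1) where
  F :=
    { obj κ := ofHom (G.F.map (arr κ)) (G.mem (arr_mem κ))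
      map f := homMk (G.F.map (topMap f)) (G.F.map (botMap f))
        (((G.F.map_comp _ _).symm.trans (congrArg G.F.map (w f))).trans (G.F.map_comp _ _))
      map_id _ := hom_ext (G.F.map_id _) (G.F.map_id _)
      map_comp _ _ := hom_ext (G.F.map_comp _ _) (G.F.map_comp _ _) }
  mem {_ _ f} hf := by
    obtain ⟨P, p₁, p₂, p, hp, hpE⟩ := exists_isComparison hf
    exact mem_succ_iff.2 ⟨G.mem (botMap_mem hf), _, _, _, _, G.isComparison hp (botMap_mem hf),
      G.mem hpE⟩
  isPullback h hf := isPullback_of_components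
    (G.isPullback (isPullback_topMap h hf) (topMap_mem hf))
    (G.isPullback (isPullback_botMap h hf) (botMap_mem hf))

/-- The codomain functor. -/
def botFunctor (n : ℕ) : ExtFunctor.{v, u} C (n + 1) n where
  F := { obj := bot, map := botMap }
  mem := botMap_mem
  isPullback := isPullback_botMap

/-- The functor which restricts an `(n + 1)`-cube to the face on which the coordinate with index `i`
is `1`. If `n < i`, then the last coordinate is meant. -/
def face : ∀ _ n : ℕ, ExtFunctor.{v, u} C (n + 1) n
  | 0, n => botFunctor n
  | _ + 1, 0 => botFunctor 0
  | i + 1, n + 1 => (face i n).lift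

lemma onFaces_face {Q : ∀ n, MorphismProperty (NExt.{v, u} C n)} :
    ∀ {i n : ℕ} {κ μ : NExt.{v, u} C (n + 1)} {f : κ ⟶ μ},
      onFaces Q (i + 1) (n + 1) f → onFaces Q i n ((face i n).F.map f)
  | 0, _, _, _, _, h => h.2
  | _ + 1, 0, _, _, _, h => h.2
  | _ + 1, _ + 1, _, _, _, h => ⟨onFaces_face h.1, onFaces_face h.2⟩

lemma mem_of_onFaces_cartesian : ∀ {i n : ℕ} (_ : i ≤ n) {κ μ : NExt.{v, u} C (n + 1)} {f : κ ⟶ μ},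
    onFaces (cartesian.{v, u} C) i (n + 1) f → extensions.{v, u} C n ((face i n).F.map f) →
      extensions.{v, u} C (n + 1) f
  | 0, _, _, _, _, _, hc, hf => mem_of_cartesian hc hf
  | i + 1, n + 1, hi, κ, μ, f, hc, hf => by
    have hi := Nat.le_of_succ_le_succ hi
    have hb : extensions.{v, u} C (n + 1) (botMap f) :=
      mem_of_onFaces_cartesian hi hc.2 (botMap_mem hf)
    obtain ⟨P, p₁, p₂, hP⟩ := exists_isPullback_of_mem hb (arr μ)
    have hp := isComparison_lift hP (w f)
    refine mem_succ_iff.2 ⟨hb, P, p₁, p₂, _, hp, mem_of_onFaces_cartesian hi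
      (onFaces_cartesian_of_isComparison hp hb hc.2 hc.1) ?_⟩
    exact (mem_succ_iff.1 hf).2.mem ((face i n).isComparison hp hb)

lemma mem_of_onFaces_cartesian_of_iso {i n : ℕ} (hi : i ≤ n) {κ μ : NExt.{v, u} C (n + 1)}
    {f : κ ⟶ μ} (hc : onFaces (cartesian.{v, u} C) i (n + 1) f) {σ : NExt.{v, u} C n}
    {g : σ ⟶ (face i n).F.obj μ} (hg : extensions.{v, u} C n g) (θ : (face i n).F.obj κ ≅ σ)
    (hθ : θ.hom ≫ g = (face i n).F.map f) : extensions.{v, u} C (n + 1) f :=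
  mem_of_onFaces_cartesian hi hc
    (hθ ▸ (extensions.{v, u} C n).comp_mem _ _ ((extensions.{v, u} C n).of_isIso _) hg)

lemma exists_onFaces_cartesian_of_face : ∀ {i n : ℕ} (_ : i ≤ n) (κ : NExt.{v, u} C (n + 1))
    {σ : NExt.{v, u} C n} (g : σ ⟶ (face i n).F.obj κ), extensions.{v, u} C n g →
    ∃ (κ' : NExt.{v, u} C (n + 1)) (f : κ' ⟶ κ) (θ : (face i n).F.obj κ' ≅ σ),
      onFaces (cartesian.{v, u} C) i (n + 1) f ∧ θ.hom ≫ g = (face i n).F.map f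
  | 0, n, _, κ, _, g, _ => by
    obtain ⟨P, p₁, p₂, hP⟩ := exists_isPullback_of_mem (arr_mem κ) g
    exact ⟨ofHom p₂ (MorphismProperty.of_isPullback hP (arr_mem κ)), homMk p₁ g hP.w, Iso.refl _,
      hP, Category.id_comp _⟩
  | i + 1, n + 1, hi, κ, σ, g, hg => by
    have hi := Nat.le_of_succ_le_succ hi
    let G := face.{v, u} (C := C) i n
    obtain ⟨β, b, θb, hcb, hθb⟩ := exists_onFaces_cartesian_of_face hi (bot κ) (botMap g)
      (botMap_mem hg)
    have hb := mem_of_onFaces_cartesian_of_iso hi hcb (botMap_mem hg) θb hθb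
    obtain ⟨P, p₁, p₂, hP⟩ := exists_isPullback_of_mem hb (arr κ)
    have hGP : IsPullback (G.F.map p₁ ≫ θb.hom) (G.F.map p₂) (botMap g) (G.F.map (arr κ)) :=
      (G.isPullback hP hb).of_iso (Iso.refl _) θb (Iso.refl _) (Iso.refl _) (by simp) (by simp)
        ((Category.comp_id _).trans hθb.symm)
        ((Category.comp_id _).trans (Category.id_comp _).symm)
    have hq := isComparison_lift hGP (w g)
    have hqE := (mem_succ_iff.1 hg).2.mem hq
    obtain ⟨τ, k, θt, hck, hθt⟩ := exists_onFaces_cartesian_of_face hi P _ hqE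
    have hk := mem_of_onFaces_cartesian_of_iso hi hck hqE θt hθt
    have hkw : (k ≫ p₂) ≫ arr κ = (k ≫ p₁) ≫ b := by
      rw [Category.assoc, Category.assoc, hP.w]
    have hθ : θt.hom ≫ arr σ = G.F.map (k ≫ p₁) ≫ θb.hom := by
      rw [Functor.map_comp, Category.assoc, ← hθt, Category.assoc]
      exact congrArg (θt.hom ≫ ·) hq.fst.symm
    have hθg : θt.hom ≫ topMap g = G.F.map (k ≫ p₂) := by
      rw [Functor.map_comp, ← hθt, Category.assoc]
      exact congrArg (θt.hom ≫ ·) hq.snd.symm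
    exact ⟨ofHom (k ≫ p₁) ((extensions.{v, u} C (n + 1)).comp_mem _ _ hk
        (MorphismProperty.of_isPullback hP.flip (arr_mem κ))),
      homMk (k ≫ p₂) b hkw, isoMk θt θb hθ,
      ⟨onFaces_cartesian_comp_snd hP hb hcb hck, hcb⟩, hom_ext hθg hθb⟩

end NExt

namespace GaloisTower

open NExt GaloisStructure

variable {C : Type (max u v)} [Category.{v} C] {T : GaloisTower.{v, u} C}

/-! ### Normalisation of a multiple extension -/

section Normal

variable (T) in
/-- The multiple extensions which are trivial coverings, when seen as an arrow. -/
def IsTrivial : ∀ n : ℕ, ObjectProperty (NExt.{v, u} C n)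
  | 0 => ⊤
  | n + 1 => fun κ => (T.Γ n).IsTrivialCovering (arr κ)

variable (T) in
/-- The multiple extensions whose reflection among the coverings is a trivial covering. -/
def HasTrivialReflection (n : ℕ) : ObjectProperty (NExt.{v, u} C n) := fun κ =>
  ∀ ⦃μ : NExt.{v, u} C n⦄ (r : κ ⟶ μ), (T.Γ n).IsReflection r → T.IsTrivial n μ

variable [Regular C] {n : ℕ}

lemma exists_discFib_of_isReflection {κ μ κ' μ' : NExt.{v, u} C n} {f : κ ⟶ μ}
    (hf : discFib.{v, u} C n f) {r : κ ⟶ κ'} {s : μ ⟶ μ'} (hr : (T.Γ n).IsReflection r)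
    (hs : (T.Γ n).IsReflection s) : ∃ g : κ' ⟶ μ', r ≫ g = f ≫ s ∧ discFib.{v, u} C n g := by
  obtain ⟨g, hg, -⟩ := hr.2 hs.1 (f ≫ s)
  have hgE := (T.stronglyBirkhoff n).mem_of_isReflection (discFib_le_extensions n _ hf) hr hs hg
  exact ⟨g, hg, discFib_of_isPullback_of_mem
    ((T.isTrivialCovering_of_discFib hf).isPullback hr hs hg) hs.mem hgE hf⟩

lemma isTrivialCovering_arr_of_discFib {κ μ : NExt.{v, u} C (n + 1)} {f : κ ⟶ μ}
    (hf : discFib.{v, u} C (n + 1) f)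
    (h : ∀ {K : NExt.{v, u} C n} {k₁ : K ⟶ bot κ} {k₂ : K ⟶ top μ},
      IsPullback k₁ k₂ (botMap f) (arr μ) → (T.Γ n).IsTrivialCovering k₁) :
    (T.Γ n).IsTrivialCovering (arr κ) := by
  obtain ⟨-, K, k₁, k₂, k, hk, hkD⟩ := hf
  rw [← hk.fst]
  exact (T.isTrivialCovering_of_discFib hkD).comp (T.stronglyBirkhoff n) (h hk.isPullback)

lemma HasTrivialReflection.of_discFib : ∀ {n : ℕ} {κ μ : NExt.{v, u} C n} {f : κ ⟶ μ},
    discFib.{v, u} C n f → T.HasTrivialReflection n μ → T.HasTrivialReflection n κ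
  | 0, _, _, _, _, _ => fun _ _ _ => trivial
  | n + 1, κ, μ, f, hf, h => fun κ' r hr => by
    have hs := (T.Γ (n + 1)).isReflection_unit μ
    obtain ⟨g, -, hg⟩ := exists_discFib_of_isReflection hf hr hs
    exact isTrivialCovering_arr_of_discFib hg fun hK =>
      (h _ hs).of_isPullback (T.stronglyBirkhoff n) hK.flip

variable (T) in
/-- Pull `κ` back along an extension which trivialises the covering that is its reflection. -/
lemma exists_cartesian_hasTrivialReflection (κ : NExt.{v, u} C (n + 1)) :
    ∃ (κ' : NExt.{v, u} C (n + 1)) (f : κ' ⟶ κ), extensions.{v, u} C (n + 1) f ∧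
      cartesian.{v, u} C (n + 1) f ∧ T.HasTrivialReflection (n + 1) κ' := by
  let r := (T.Γ (n + 1)).unit κ
  have hr : (T.Γ (n + 1)).IsReflection r := (T.Γ (n + 1)).isReflection_unit κ
  have := isIso_botMap_of_isReflection hr
  obtain ⟨-, S, e, he, P, t, x, hP, ht⟩ := (T.X_succ_iff _).1 hr.1
  let c : S ⟶ bot κ := e ≫ inv (botMap r)
  have hc : extensions.{v, u} C n c :=
    (extensions.{v, u} C n).comp_mem _ _ he ((extensions.{v, u} C n).of_isIso _)
  obtain ⟨K, k₁, k₂, hK⟩ := exists_isPullback_of_mem (arr_mem κ) c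
  let κ' : NExt.{v, u} C (n + 1) := ofHom k₂ (MorphismProperty.of_isPullback hK (arr_mem κ))
  let f : κ' ⟶ κ := homMk k₁ c hK.w
  have hf : cartesian.{v, u} C (n + 1) f := hK
  have hfE := mem_of_cartesian hf hc
  refine ⟨κ', f, hfE, hf, fun κ'' r' hr' => ?_⟩
  obtain ⟨g, hg, hgD⟩ := exists_discFib_of_isReflection (discFib_of_cartesian hfE hf) hr' hr
  let q : S ⟶ bot κ'' := botMap r'
  have : IsIso q := isIso_botMap_of_isReflection hr'
  have hq : botMap g = inv q ≫ e := by
    have hce : c ≫ botMap r = e := by rw [Category.assoc, IsIso.inv_hom_id, Category.comp_id]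
    rw [← hce]
    exact (IsIso.eq_inv_comp q).2 (botMap_comm hg)
  refine isTrivialCovering_arr_of_discFib hgD fun {L l₁ l₂} hL => ?_
  rw [hq] at hL
  exact ht.of_isPullback (T.stronglyBirkhoff n) (IsPullback.of_right' hL.flip hP)

variable (T) in
lemma exists_facesSatisfy_hasTrivialReflection : ∀ {i n : ℕ} (_ : i ≤ n)
    (κ : NExt.{v, u} C (n + 1)), ∃ (κ' : NExt.{v, u} C (n + 1)) (f : κ' ⟶ κ),
      extensions.{v, u} C (n + 1) f ∧ onFaces (cartesian.{v, u} C) i (n + 1) f ∧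
      FacesSatisfy T.HasTrivialReflection i (n + 1) κ'
  | 0, n, _, κ => T.exists_cartesian_hasTrivialReflection κ
  | i + 1, n + 1, hi, κ => by
    have hi := Nat.le_of_succ_le_succ hi
    obtain ⟨β, b, hb, hcb, hTb⟩ := exists_facesSatisfy_hasTrivialReflection hi (bot κ)
    obtain ⟨P, p₁, p₂, hP⟩ := exists_isPullback_of_mem hb (arr κ)
    obtain ⟨τ, k, hk, hck, hTt⟩ := exists_facesSatisfy_hasTrivialReflection hi P
    have hkw : (k ≫ p₂) ≫ arr κ = (k ≫ p₁) ≫ b := by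
      rw [Category.assoc, Category.assoc, hP.w]
    exact ⟨ofHom (k ≫ p₁) ((extensions.{v, u} C (n + 1)).comp_mem _ _ hk
        (MorphismProperty.of_isPullback hP.flip (arr_mem κ))), homMk (k ≫ p₂) b hkw,
      NExt.mem_succ_iff.2 ⟨hb, P, p₁, p₂, k, ⟨hP, rfl, rfl⟩, hk⟩,
      ⟨onFaces_cartesian_comp_snd hP hb hcb hck, hcb⟩, hTt, hTb⟩

variable (T) in
/-- An inductive condition on multiple extensions under which the reflection can be computed in the
first `i` directions one after another. -/
def IsNormal : ∀ _ n : ℕ, ObjectProperty (NExt.{v, u} C n)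
  | 0, _ => ⊤
  | _ + 1, 0 => ⊤
  | i + 1, n + 1 => fun κ => IsNormal i (n + 1) κ ∧
      FacesSatisfy T.HasTrivialReflection i (n + 1) κ ∧ IsNormal i n ((face i n).F.obj κ)

lemma IsNormal.of_onFaces_discFib : ∀ {i n : ℕ} {κ μ : NExt.{v, u} C n} {f : κ ⟶ μ},
    extensions.{v, u} C n f → onFaces (discFib.{v, u} C) i n f → T.IsNormal i n μ →
      T.IsNormal i n κ
  | 0, _, _, _, _, _, _, _ => trivial
  | _ + 1, 0, _, _, _, _, _, _ => trivial
  | i + 1, n + 1, _, _, _, hf, hD, h =>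
    have hD' := onFaces_discFib_of_succ hf hD
    ⟨of_onFaces_discFib hf hD' h.1,
      FacesSatisfy.dom_of_onFaces HasTrivialReflection.of_discFib hD' h.2.1,
      of_onFaces_discFib ((face i n).mem hf) (onFaces_face hD) h.2.2⟩

variable (T) in
lemma exists_discFib_isNormal : ∀ {i n : ℕ} (_ : i ≤ n) (κ : NExt.{v, u} C n),
    ∃ (κ' : NExt.{v, u} C n) (f : κ' ⟶ κ), discFib.{v, u} C n f ∧ T.IsNormal i n κ'
  | 0, n, _, κ => ⟨κ, 𝟙 κ, (discFib.{v, u} C n).id_mem _, trivial⟩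
  | i + 1, n + 1, hi, κ => by
    have hi' := Nat.le_of_succ_le_succ hi
    obtain ⟨κ₁, f₁, hf₁, h₁⟩ := exists_discFib_isNormal (Nat.le_of_succ_le hi) κ
    obtain ⟨κ₂, f₂, hf₂, hc₂, h₂⟩ := T.exists_facesSatisfy_hasTrivialReflection hi' κ₁
    obtain ⟨σ, g, hg, hσ⟩ := exists_discFib_isNormal hi' ((face i n).F.obj κ₂)
    have hgE := discFib_le_extensions n _ hg
    obtain ⟨κ₃, f₃, θ, hc₃, hθ⟩ := exists_onFaces_cartesian_of_face hi' κ₂ g hgE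
    have hf₃ := mem_of_onFaces_cartesian_of_iso hi' hc₃ hgE θ hθ
    have hD₂ := onFaces_discFib_of_cartesian hf₂ hc₂
    have hD₃ := onFaces_discFib_of_cartesian hf₃ hc₃
    exact ⟨κ₃, f₃ ≫ f₂ ≫ f₁, (discFib.{v, u} C (n + 1)).comp_mem _ _ (discFib_of_onFaces hf₃ hD₃)
        ((discFib.{v, u} C (n + 1)).comp_mem _ _ (discFib_of_onFaces hf₂ hD₂) hf₁),
      IsNormal.of_onFaces_discFib hf₃ hD₃ (IsNormal.of_onFaces_discFib hf₂ hD₂ h₁),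
      FacesSatisfy.dom_of_onFaces HasTrivialReflection.of_discFib hD₃ h₂,
      IsNormal.of_onFaces_discFib ((extensions.{v, u} C n).of_isIso θ.hom)
        (onFaces_of_isIso θ.hom) hσ⟩

end Normal

/-! ### Reflections of the faces of a cube -/

section Reflections

variable (T) in
/-- The reflections in a tower of Galois structures, as classes of morphisms. -/
def reflections (n : ℕ) : MorphismProperty (NExt.{v, u} C n) := fun _ _ f => (T.Γ n).IsReflection f

variable (T) in
/-- The reflective subcategories in a tower of Galois structures, as a sequence. -/
def base (n : ℕ) : ObjectProperty (NExt.{v, u} C n) := (T.Γ n).X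

lemma facesSatisfy_base_of_onFaces_reflections {i n : ℕ} {κ μ : NExt.{v, u} C n} {f : κ ⟶ μ}
    (hf : onFaces T.reflections i n f) : FacesSatisfy T.base i n μ :=
  FacesSatisfy.of_onFaces (fun hf => hf.1) hf

lemma existsUnique_of_onFaces_reflections : ∀ {i n : ℕ} {κ μ β : NExt.{v, u} C n} {f : κ ⟶ μ},
    onFaces T.reflections i n f → FacesSatisfy T.base i n β →
      ∀ g : κ ⟶ β, ∃! h : μ ⟶ β, f ≫ h = g
  | 0, _, _, _, _, _, hf, hβ, g => hf.2 hβ g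
  | _ + 1, 0, _, _, _, _, hf, hβ, g => hf.2 hβ g
  | _ + 1, _ + 1, κ, μ, β, f, hf, hβ, g => by
    obtain ⟨t, ht, ht'⟩ := existsUnique_of_onFaces_reflections hf.1 hβ.1 (topMap g)
    obtain ⟨s, hs, hs'⟩ := existsUnique_of_onFaces_reflections hf.2 hβ.2 (botMap g)
    have hts : t ≫ arr β = arr μ ≫ s := by
      refine (existsUnique_of_onFaces_reflections hf.1 hβ.2 (topMap g ≫ arr β)).unique ?_ ?_
      · rw [← Category.assoc, ht]
      · rw [← Category.assoc, w, Category.assoc, hs, w]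
    exact ⟨homMk t s hts, hom_ext ht hs, fun h hh =>
      hom_ext (ht' _ (by rw [← hh, topMap_comp])) (hs' _ (by rw [← hh, botMap_comp]))⟩

lemma hom_ext_of_onFaces_reflections {i n : ℕ} {κ μ β : NExt.{v, u} C n} {f : κ ⟶ μ}
    (hf : onFaces T.reflections i n f) (hβ : FacesSatisfy T.base i n β) {h k : μ ⟶ β}
    (hk : f ≫ h = f ≫ k) : h = k :=
  (existsUnique_of_onFaces_reflections hf hβ (f ≫ k)).unique hk rfl

lemma exists_iso_of_onFaces_reflections {i n : ℕ} {κ μ μ' : NExt.{v, u} C n} {f : κ ⟶ μ}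
    {f' : κ ⟶ μ'} (hf : onFaces T.reflections i n f) (hf' : onFaces T.reflections i n f') :
    ∃ θ : μ ≅ μ', f ≫ θ.hom = f' := by
  have hμ := facesSatisfy_base_of_onFaces_reflections hf
  have hμ' := facesSatisfy_base_of_onFaces_reflections hf'
  obtain ⟨h, hh, -⟩ := existsUnique_of_onFaces_reflections hf hμ' f'
  obtain ⟨k, hk, -⟩ := existsUnique_of_onFaces_reflections hf' hμ f
  exact ⟨⟨h, k,
    hom_ext_of_onFaces_reflections hf hμ (by rw [reassoc_of% hh, hk, Category.comp_id]),
    hom_ext_of_onFaces_reflections hf' hμ' (by rw [reassoc_of% hk, hh, Category.comp_id])⟩, hh⟩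

lemma onFaces_reflections_iso_comp : ∀ {i n : ℕ} {κ μ ν : NExt.{v, u} C n} (f : κ ⟶ μ) [IsIso f]
    {g : μ ⟶ ν}, onFaces T.reflections i n g → onFaces T.reflections i n (f ≫ g)
  | 0, _, _, _, _, f, _, _, hg => IsReflection.iso_comp hg f
  | _ + 1, 0, _, _, _, f, _, _, hg => IsReflection.iso_comp hg f
  | _ + 1, _ + 1, _, _, _, f, _, _, hg =>
    ⟨onFaces_reflections_iso_comp (topMap f) hg.1, onFaces_reflections_iso_comp (botMap f) hg.2⟩

variable [Regular C]

lemma isIso_face_map_of_onFaces_reflections : ∀ {i n : ℕ} (_ : i ≤ n)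
    {κ μ : NExt.{v, u} C (n + 1)} {f : κ ⟶ μ},
      onFaces T.reflections i (n + 1) f → IsIso ((face i n).F.map f)
  | 0, _, _, _, _, _, hf => isIso_botMap_of_isReflection hf
  | _ + 1, _ + 1, hi, _, _, _, hf => isIso_of_components _
      (isIso_face_map_of_onFaces_reflections (Nat.le_of_succ_le_succ hi) hf.1)
      (isIso_face_map_of_onFaces_reflections (Nat.le_of_succ_le_succ hi) hf.2)

lemma isReflection_topMap_comp {n : ℕ} {κ μ ν : NExt.{v, u} C (n + 1)} {f : κ ⟶ μ} {g : μ ⟶ ν}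
    (hf : (T.Γ (n + 1)).IsReflection f) (hg : (T.Γ n).IsReflection (topMap g)) :
    (T.Γ n).IsReflection (topMap (f ≫ g)) := by
  refine ⟨hg.1, fun b hb x => ?_⟩
  have := IsExtensionClass.epi (topMap_mem hf.mem)
  obtain ⟨y, hy⟩ := exists_topMap_comp_eq hf hb x
  obtain ⟨z, hz, -⟩ := hg.2 hb y
  have hfz : (topMap f ≫ topMap g) ≫ z = x := by rw [Category.assoc, hz, hy]
  refine ⟨z, hfz, fun z' hz' => hg.hom_ext hb ?_⟩
  rw [← cancel_epi (topMap f), hz, hy, ← hz', topMap_comp, Category.assoc]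

lemma onFaces_reflections_comp : ∀ {i n : ℕ} (_ : i ≤ n) {κ μ ν : NExt.{v, u} C (n + 1)}
    {f : κ ⟶ μ} {g : μ ⟶ ν}, onFaces T.reflections i (n + 1) f →
      onFaces T.reflections (i + 1) (n + 1) g → onFaces T.reflections (i + 1) (n + 1) (f ≫ g)
  | 0, _, _, _, _, _, f, _, hf, hg =>
    have := isIso_botMap_of_isReflection hf
    ⟨isReflection_topMap_comp hf hg.1, IsReflection.iso_comp hg.2 (botMap f)⟩
  | _ + 1, _ + 1, hi, _, _, _, _, _, hf, hg =>
    ⟨onFaces_reflections_comp (Nat.le_of_succ_le_succ hi) hf.1 hg.1,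
      onFaces_reflections_comp (Nat.le_of_succ_le_succ hi) hf.2 hg.2⟩

lemma exists_cartesian_of_isReflection_bot {n : ℕ} {μ : NExt.{v, u} C (n + 1)}
    (hμ : T.IsTrivial (n + 1) μ) {σ : NExt.{v, u} C n} {x : bot μ ⟶ σ}
    (hx : (T.Γ n).IsReflection x) : ∃ (lam : NExt.{v, u} C (n + 1)) (p : μ ⟶ lam),
      extensions.{v, u} C (n + 1) p ∧ cartesian.{v, u} C (n + 1) p ∧
      onFaces T.reflections 1 (n + 1) p := by
  let t := (T.Γ n).unit (top μ)
  have ht : (T.Γ n).IsReflection t := (T.Γ n).isReflection_unit (top μ)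
  obtain ⟨f, hf, -⟩ := ht.2 hx.1 (arr μ ≫ x)
  have hfE := (T.stronglyBirkhoff n).mem_of_isReflection (arr_mem μ) ht hx hf
  have hP : IsPullback t (arr μ) f x := IsTrivialCovering.isPullback hμ ht hx hf
  let p : μ ⟶ ofHom f hfE := homMk t x hP.w
  have hp : cartesian.{v, u} C (n + 1) p := hP
  exact ⟨_, p, mem_of_cartesian hp hx.mem, hp, ht, hx⟩

/-- By the universal property, `x` is determined up to isomorphism by `t` and `b`, which reflect the
two ends of the face. -/
lemma exists_iso_face_of_onFaces_reflections {i n : ℕ} {κ : NExt.{v, u} C (n + 1 + 1)}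
    {σ : NExt.{v, u} C (n + 1)} {x : (face (i + 1) (n + 1)).F.obj κ ⟶ σ}
    (hx : onFaces T.reflections (i + 1) (n + 1) x) {μ ν : NExt.{v, u} C (n + 1)} {t : top κ ⟶ μ}
    {b : bot κ ⟶ ν} (ht : onFaces T.reflections (i + 1) (n + 1) t)
    (hb : onFaces T.reflections (i + 1) (n + 1) b) {h : μ ⟶ ν} (hh : t ≫ h = arr κ ≫ b)
    (hhE : extensions.{v, u} C (n + 1) h) :
    ∃ e : σ ≅ ofHom ((face i n).F.map h) ((face i n).mem hhE),
      topMap (x ≫ e.hom) = (face i n).F.map t ∧ botMap (x ≫ e.hom) = (face i n).F.map b := by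
  let xt : (face i n).F.obj (top κ) ⟶ top σ := topMap x
  let xb : (face i n).F.obj (bot κ) ⟶ bot σ := botMap x
  obtain ⟨θt, hθt : xt ≫ θt.hom = _⟩ := exists_iso_of_onFaces_reflections hx.1 (onFaces_face ht)
  obtain ⟨θb, hθb : xb ≫ θb.hom = _⟩ := exists_iso_of_onFaces_reflections hx.2 (onFaces_face hb)
  have hθ : θt.hom ≫ (face i n).F.map h = arr σ ≫ θb.hom := by
    refine hom_ext_of_onFaces_reflections hx.1
      (facesSatisfy_base_of_onFaces_reflections (onFaces_face hb)) ?_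
    have hxw : xt ≫ arr σ = (face i n).F.map (arr κ) ≫ xb := NExt.w x
    change xt ≫ θt.hom ≫ (face i n).F.map h = xt ≫ arr σ ≫ θb.hom
    rw [reassoc_of% hθt, reassoc_of% hxw, hθb, ← Functor.map_comp, ← Functor.map_comp, hh]
  exact ⟨isoMk θt θb hθ, hθt, hθb⟩

lemma exists_onFaces_reflections_of_face : ∀ {i n : ℕ} (_ : i ≤ n) {μ : NExt.{v, u} C (n + 1)},
    FacesSatisfy T.IsTrivial i (n + 1) μ → ∀ {σ : NExt.{v, u} C n} (x : (face i n).F.obj μ ⟶ σ),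
    extensions.{v, u} C n x → onFaces T.reflections i n x →
    ∃ (lam : NExt.{v, u} C (n + 1)) (p : μ ⟶ lam), extensions.{v, u} C (n + 1) p ∧
      onFaces (cartesian.{v, u} C) i (n + 1) p ∧ onFaces T.reflections (i + 1) (n + 1) p
  | 0, n, _, μ, hμ, σ, x, _, hr => exists_cartesian_of_isReflection_bot (x := x) hμ hr
  | i + 1, n + 1, hi, μ, hμ, σ, x, hx, hr => by
    have hi := Nat.le_of_succ_le_succ hi
    obtain ⟨lt, t, htE, hct, hrt⟩ :=
      exists_onFaces_reflections_of_face hi hμ.1 (topMap x) (topMap_mem hx) hr.1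
    obtain ⟨lb, b, hbE, hcb, hrb⟩ :=
      exists_onFaces_reflections_of_face hi hμ.2 (botMap x) (botMap_mem hx) hr.2
    obtain ⟨h, hh, -⟩ := existsUnique_of_onFaces_reflections hrt
      (facesSatisfy_base_of_onFaces_reflections hrb) (arr μ ≫ b)
    have hhE : extensions.{v, u} C (n + 1) h := MorphismProperty.of_precomp _ _ _ htE
      (hh ▸ (extensions.{v, u} C (n + 1)).comp_mem _ _ (arr_mem μ) hbE)
    obtain ⟨P, p₁, p₂, hP⟩ := exists_isPullback_of_mem hbE h
    have hk := isComparison_lift hP hh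
    obtain ⟨e, het, heb⟩ := exists_iso_face_of_onFaces_reflections hr hrt hrb hh hhE
    have hxe : extensions.{v, u} C (n + 1) (x ≫ e.hom) :=
      (extensions.{v, u} C (n + 1)).comp_mem _ _ hx ((extensions.{v, u} C (n + 1)).of_isIso _)
    have hkE := mem_of_onFaces_cartesian hi (onFaces_cartesian_of_isComparison hk hbE hcb hct) <| by
      have hc := (NExt.mem_succ_iff.1 hxe).2
      rw [het, heb] at hc
      exact hc.mem ((face i n).isComparison hk hbE)
    exact ⟨ofHom h hhE, homMk t b hh, NExt.mem_succ_iff.2 ⟨hbE, P, p₁, p₂, _, hk, hkE⟩, ⟨hct, hcb⟩,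
      hrt, hrb⟩

lemma IsNormal.exists_reflection : ∀ {i n : ℕ} (_ : i ≤ n) {κ : NExt.{v, u} C n},
    T.IsNormal i n κ → ∃ (κ' lam : NExt.{v, u} C n) (r : κ ⟶ κ') (d : κ' ⟶ lam),
      (T.Γ n).IsReflection r ∧ discFib.{v, u} C n d ∧ onFaces T.reflections i n (r ≫ d)
  | 0, n, _, κ, _ => ⟨_, _, (T.Γ n).unit κ, 𝟙 _, (T.Γ n).isReflection_unit κ,
      (discFib.{v, u} C n).id_mem _, by
        rw [Category.comp_id]
        exact (T.Γ n).isReflection_unit κ⟩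
  | i + 1, n + 1, hi, κ, h => by
    have hi' := Nat.le_of_succ_le_succ hi
    obtain ⟨κ', μ, r, d, hr, hd, hrd⟩ := IsNormal.exists_reflection (Nat.le_of_succ_le hi) h.1
    obtain ⟨s, σ, r', d', hr', hd', hrd'⟩ := IsNormal.exists_reflection hi' h.2.2
    have hμ : FacesSatisfy T.IsTrivial i (n + 1) μ :=
      FacesSatisfy.cod_of_onFaces (Q := T.reflections) (fun hf hκ => hκ _ hf) hrd h.2.1
    have := isIso_face_map_of_onFaces_reflections hi' hrd
    have hrdE : extensions.{v, u} C n (r' ≫ d') :=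
      (extensions.{v, u} C n).comp_mem _ _ hr'.mem (discFib_le_extensions n _ hd')
    obtain ⟨lam, p, hp, hcp, hrp⟩ := exists_onFaces_reflections_of_face hi' hμ
      (inv ((face i n).F.map (r ≫ d)) ≫ r' ≫ d')
      ((extensions.{v, u} C n).comp_mem _ _ ((extensions.{v, u} C n).of_isIso _) hrdE)
      (onFaces_reflections_iso_comp _ hrd')
    refine ⟨κ', lam, r, d ≫ p, hr, (discFib.{v, u} C (n + 1)).comp_mem _ _ hd
      (discFib_of_onFaces hp (onFaces_discFib_of_cartesian hp hcp)), ?_⟩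
    rw [← Category.assoc]
    exact onFaces_reflections_comp hi' hrd hrp

end Reflections

/-! ### Coverings and spans of discrete fibrations -/

section Span

variable (T) in
/-- The multiple extensions all whose vertices belong to the base, described inductively; see
`liesInBase_iff` for the comparison with `LiesInBase`. -/
def VerticesInBase : ∀ n : ℕ, ObjectProperty (NExt.{v, u} C n)
  | 0 => (T.Γ 0).X
  | n + 1 => fun κ => VerticesInBase n (top κ) ∧ VerticesInBase n (bot κ)

lemma verticesInBase_of_facesSatisfy : ∀ {n : ℕ} {κ : NExt.{v, u} C n},
    FacesSatisfy T.base n n κ → T.VerticesInBase n κ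
  | 0, _, h => h
  | _ + 1, _, h => ⟨verticesInBase_of_facesSatisfy h.1, verticesInBase_of_facesSatisfy h.2⟩

variable [Regular C]

lemma VerticesInBase.X : ∀ {n : ℕ} {κ : NExt.{v, u} C n}, T.VerticesInBase n κ → (T.Γ n).X κ
  | 0, _, h => h
  | n + 1, κ, h => (T.X_succ_iff κ).2
      ((T.stronglyBirkhoff n).isTrivialCovering_of_mem (arr_mem κ) h.1.X).isCovering

theorem isCovering_iff_exists_span_discFib {n : ℕ} (α : NExt.{v, u} C (n + 1)) :
    T.IsCovering α ↔ ∃ (β τ : NExt.{v, u} C (n + 1)) (φ : τ ⟶ β) (ψ : τ ⟶ α),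
      discFib.{v, u} C (n + 1) φ ∧ discFib.{v, u} C (n + 1) ψ ∧ T.VerticesInBase (n + 1) β := by
  refine ⟨fun h => ?_, ?_⟩
  · obtain ⟨τ, ψ, hψ, hτ⟩ := T.exists_discFib_isNormal le_rfl α
    obtain ⟨κ', β, r, d, hr, hd, hrd⟩ := hτ.exists_reflection le_rfl
    have := hr.isIso ((T.X_succ_iff τ).2 ((isCovering_iff_of_discFib hψ).2 h))
    have hrdD := (discFib.{v, u} C (n + 1)).comp_mem _ _ ((discFib.{v, u} C (n + 1)).of_isIso r) hd
    exact ⟨β, τ, r ≫ d, ψ, hrdD, hψ,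
      verticesInBase_of_facesSatisfy (facesSatisfy_base_of_onFaces_reflections hrd)⟩
  · rintro ⟨β, τ, φ, ψ, hφ, hψ, hβ⟩
    exact (isCovering_iff_of_discFib hψ).1 ((isCovering_iff_of_discFib hφ).2
      ((T.X_succ_iff β).1 hβ.X))

end Span

end GaloisTower

/-! ### Filling problems -/

section Filling

universe v₁ v₂ v₃ v₄ u₁ u₂ u₃ u₄

variable {J : Type u₁} [Category.{v₁} J] {C : Type u₃} [Category.{v₃} C]

/-- A matching family at `x` for a morphism `f : A ⟶ B` of diagrams: a generalized element, defined
on `T`, of the object through which the universal map `A.obj x ⟶ B.obj x` would factor in Reedy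
theory. It consists of an element of `B.obj x` and a compatible family of elements of `A` beyond
`x`. "Beyond `x`" is expressed by morphisms out of `x` that are not isomorphisms, so that the notion
is invariant under equivalence of the indexing categories. -/
@[ext]
structure MatchingFamily {A B : J ⥤ C} (f : A ⟶ B) (x : J) (T : C) where
  base : T ⟶ B.obj x
  app ⦃y : J⦄ (h : x ⟶ y) : ¬ IsIso h → (T ⟶ A.obj y)
  app_map ⦃y z : J⦄ (h : x ⟶ y) (hh : ¬ IsIso h) (k : y ⟶ z) (hk : ¬ IsIso (h ≫ k)) :
    app h hh ≫ A.map k = app (h ≫ k) hk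
  app_comp ⦃y : J⦄ (h : x ⟶ y) (hh : ¬ IsIso h) : app h hh ≫ f.app y = base ≫ B.map h

/-- An element `s` of `A.obj x`, defined on `S`, which restricts to the given matching family along
`e : S ⟶ T`. -/
structure MatchingFamily.IsFilling {A B : J ⥤ C} {f : A ⟶ B} {x : J} {T S : C}
    (t : MatchingFamily f x T) (e : S ⟶ T) (s : S ⟶ A.obj x) : Prop where
  comp_app : s ≫ f.app x = e ≫ t.base
  comp_map ⦃y : J⦄ (h : x ⟶ y) (hh : ¬ IsIso h) : s ≫ A.map h = e ≫ t.app h hh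

/-- Each matching family at `x` has a filling after restriction along a regular epimorphism. -/
def FillsLocally {A B : J ⥤ C} (f : A ⟶ B) (x : J) : Prop :=
  ∀ ⦃T : C⦄ (t : MatchingFamily f x T),
    ∃ (S : C) (e : S ⟶ T) (s : S ⟶ A.obj x), IsRegularEpi e ∧ t.IsFilling e s

/-- Each matching family at `x` has exactly one filling. -/
def FillsUniquely {A B : J ⥤ C} (f : A ⟶ B) (x : J) : Prop :=
  ∀ ⦃T : C⦄ (t : MatchingFamily f x T), ∃! s, t.IsFilling (𝟙 T) s

/-- The filling problems for `f` at `x` and those for `g` at `y` correspond to each other. -/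
def SameFillings {J' : Type u₂} [Category.{v₂} J'] {A B : J ⥤ C} (f : A ⟶ B) (x : J)
    {A' B' : J' ⥤ C} (g : A' ⟶ B') (y : J') : Prop :=
  ∃ i : A.obj x ≅ A'.obj y, ∀ T : C,
    Relator.BiTotal fun (t : MatchingFamily f x T) (t' : MatchingFamily g y T) =>
      ∀ ⦃S : C⦄ (e : S ⟶ T) (s : S ⟶ A.obj x), t.IsFilling e s ↔ t'.IsFilling e (s ≫ i.hom)

namespace SameFillings

variable {J' : Type u₂} [Category.{v₂} J'] {J'' : Type u₄} [Category.{v₄} J'']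
  {A B : J ⥤ C} {f : A ⟶ B} {x : J} {A' B' : J' ⥤ C} {f' : A' ⟶ B'} {x' : J'}
  {A'' B'' : J'' ⥤ C} {f'' : A'' ⟶ B''} {x'' : J''}

lemma symm (h : SameFillings f x f' x') : SameFillings f' x' f x := by
  obtain ⟨i, hi⟩ := h
  refine ⟨i.symm, fun T => ⟨fun t' => ?_, fun t => ?_⟩⟩
  · obtain ⟨t, ht⟩ := (hi T).2 t'
    exact ⟨t, fun S e s => by simp [ht e]⟩
  · obtain ⟨t', ht⟩ := (hi T).1 t
    exact ⟨t', fun S e s => by simp [ht e]⟩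

lemma trans (h : SameFillings f x f' x') (h' : SameFillings f' x' f'' x'') :
    SameFillings f x f'' x'' := by
  obtain ⟨i, hi⟩ := h
  obtain ⟨j, hj⟩ := h'
  refine ⟨i ≪≫ j, fun T => ⟨fun t => ?_, fun t'' => ?_⟩⟩
  · obtain ⟨t', ht⟩ := (hi T).1 t
    obtain ⟨t'', ht'⟩ := (hj T).1 t'
    exact ⟨t'', fun S e s => by simp [ht e, ht' e]⟩
  · obtain ⟨t', ht'⟩ := (hj T).2 t''
    obtain ⟨t, ht⟩ := (hi T).2 t'
    exact ⟨t, fun S e s => by simp [ht e, ht' e]⟩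

lemma fillsLocally (h : SameFillings f x f' x') (hf : FillsLocally f x) : FillsLocally f' x' := by
  obtain ⟨i, hi⟩ := h
  intro T t'
  obtain ⟨t, ht⟩ := (hi T).2 t'
  obtain ⟨S, e, s, he, hs⟩ := hf t
  exact ⟨S, e, s ≫ i.hom, he, (ht e s).1 hs⟩

lemma fillsLocally_iff (h : SameFillings f x f' x') : FillsLocally f x ↔ FillsLocally f' x' :=
  ⟨h.fillsLocally, h.symm.fillsLocally⟩

lemma fillsUniquely (h : SameFillings f x f' x') (hf : FillsUniquely f x) :
    FillsUniquely f' x' := by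
  obtain ⟨i, hi⟩ := h
  intro T t'
  obtain ⟨t, ht⟩ := (hi T).2 t'
  obtain ⟨s, hs, hs'⟩ := hf t
  refine ⟨s ≫ i.hom, (ht _ s).1 hs, fun r hr => ?_⟩
  rw [← hs' (r ≫ i.inv) ((ht _ _).2 (by simpa using hr)), Category.assoc, Iso.inv_hom_id,
    Category.comp_id]

lemma fillsUniquely_iff (h : SameFillings f x f' x') : FillsUniquely f x ↔ FillsUniquely f' x' :=
  ⟨h.fillsUniquely, h.symm.fillsUniquely⟩

end SameFillings

section Iso

variable {A B A' B' : J ⥤ C} {f : A ⟶ B} {g : A' ⟶ B'}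

/-- The image of a matching family under an isomorphism of arrows. -/
def MatchingFamily.congr (a : A ≅ A') (b : B ≅ B') (w : a.hom ≫ g = f ≫ b.hom) {x : J} {T : C}
    (t : MatchingFamily f x T) : MatchingFamily g x T where
  base := t.base ≫ b.hom.app x
  app y h hh := t.app h hh ≫ a.hom.app y
  app_map y z h hh k hk := by
    rw [Category.assoc, ← a.hom.naturality, ← Category.assoc, t.app_map h hh k hk]
  app_comp y h hh := by
    rw [Category.assoc, ← NatTrans.comp_app, w, NatTrans.comp_app, ← Category.assoc,
      t.app_comp, Category.assoc, Category.assoc, b.hom.naturality]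

lemma MatchingFamily.isFilling_congr_iff (a : A ≅ A') (b : B ≅ B') (w : a.hom ≫ g = f ≫ b.hom)
    {x : J} {T S : C} (t : MatchingFamily f x T) (e : S ⟶ T) (s : S ⟶ A.obj x) :
    t.IsFilling e s ↔ (t.congr a b w).IsFilling e (s ≫ a.hom.app x) := by
  have hbase : s ≫ f.app x = e ≫ t.base ↔
      (s ≫ a.hom.app x) ≫ g.app x = e ≫ t.base ≫ b.hom.app x := by
    rw [Category.assoc, ← NatTrans.comp_app, w, NatTrans.comp_app, ← Category.assoc,
      ← Category.assoc, cancel_mono]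
  have happ ⦃y : J⦄ (h : x ⟶ y) (hh : ¬ IsIso h) : s ≫ A.map h = e ≫ t.app h hh ↔
      (s ≫ a.hom.app x) ≫ A'.map h = e ≫ t.app h hh ≫ a.hom.app y := by
    rw [Category.assoc, ← a.hom.naturality, ← Category.assoc, ← Category.assoc, cancel_mono]
  exact ⟨fun hs => ⟨hbase.1 hs.comp_app, fun y h hh => (happ h hh).1 (hs.comp_map h hh)⟩,
    fun hs => ⟨hbase.2 hs.comp_app, fun y h hh => (happ h hh).2 (hs.comp_map h hh)⟩⟩

lemma sameFillings_of_iso (a : A ≅ A') (b : B ≅ B') (w : a.hom ≫ g = f ≫ b.hom) (x : J) :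
    SameFillings f x g x := by
  refine ⟨a.app x, fun T => ⟨fun t => ⟨_, fun S => t.isFilling_congr_iff a b w⟩, fun t' => ?_⟩⟩
  have w' : a.symm.hom ≫ f = g ≫ b.symm.hom := by
    rw [Iso.symm_hom, Iso.symm_hom, Iso.inv_comp_eq, ← Category.assoc, w, Category.assoc,
      Iso.hom_inv_id, Category.comp_id]
  refine ⟨t'.congr a.symm b.symm w', fun S e s => ?_⟩
  rw [t'.isFilling_congr_iff a.symm b.symm w' e]
  simp

end Iso

section Whisker

variable {J' : Type u₂} [Category.{v₂} J'] {A B : J' ⥤ C} {f : A ⟶ B} {R : J ⥤ J'} [R.Full]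
  [R.Faithful] {x : J}

/-- The restriction of a matching family along a fully faithful functor. -/
def MatchingFamily.restrict {T : C} (t : MatchingFamily f (R.obj x) T) :
    MatchingFamily (Functor.whiskerLeft R f) x T where
  base := t.base
  app y h hh := t.app (R.map h) fun _ => hh (isIso_of_reflects_iso h R)
  app_map y z h hh k hk := by
    have hk' : ¬ IsIso (R.map h ≫ R.map k) := by
      rw [← R.map_comp]
      exact fun _ => hk (isIso_of_reflects_iso _ R)
    simp [t.app_map _ _ _ hk']
  app_comp y h hh := t.app_comp _ _

omit [R.Faithful] in
lemma not_isIso_preimage (hR : ∀ ⦃y' : J'⦄, (R.obj x ⟶ y') → R.essImage y') {y' : J'}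
    (h : R.obj x ⟶ y') (hh : ¬ IsIso h) : ¬ IsIso (R.preimage (h ≫ (hR h).getIso.inv)) := by
  intro hi
  have := R.map_isIso (R.preimage (h ≫ (hR h).getIso.inv))
  rw [R.map_preimage] at this
  exact hh (IsIso.of_isIso_comp_right h (hR h).getIso.inv)

/-- The extension of a matching family along a fully faithful functor whose essential image contains
all objects that receive a morphism from the given one. -/
noncomputable def MatchingFamily.extend (hR : ∀ ⦃y' : J'⦄, (R.obj x ⟶ y') → R.essImage y') {T : C}
    (t : MatchingFamily (Functor.whiskerLeft R f) x T) : MatchingFamily f (R.obj x) T where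
  base := t.base
  app _ h hh := t.app _ (not_isIso_preimage hR h hh) ≫ A.map (hR h).getIso.hom
  app_map y z h hh k hk := by
    let k' := R.preimage ((hR h).getIso.hom ≫ k ≫ (hR (h ≫ k)).getIso.inv)
    have hk' : R.preimage (h ≫ (hR h).getIso.inv) ≫ k' =
        R.preimage ((h ≫ k) ≫ (hR (h ≫ k)).getIso.inv) := R.map_injective (by simp [k'])
    have := t.app_map _ (not_isIso_preimage hR h hh) k' (by
      rw [hk']
      exact not_isIso_preimage hR _ hk)
    simp only [hk'] at this
    rw [← this]
    simp only [k', Category.assoc, Functor.comp_map, Functor.map_preimage, ← A.map_comp,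
      Iso.inv_hom_id, Category.comp_id]
  app_comp y h hh := by
    have := t.app_comp _ (not_isIso_preimage hR h hh)
    simp only [Functor.whiskerLeft_app, Functor.comp_map, Functor.map_preimage, B.map_comp] at this
    rw [Category.assoc, f.naturality, reassoc_of% this, ← B.map_comp, Iso.inv_hom_id, B.map_id]
    simp

lemma MatchingFamily.restrict_extend (hR : ∀ ⦃y' : J'⦄, (R.obj x ⟶ y') → R.essImage y') {T : C}
    (t : MatchingFamily (Functor.whiskerLeft R f) x T) : (t.extend hR).restrict = t := by
  ext y h hh
  · rfl
  · have hi : R.preimage (R.map h ≫ (hR (R.map h)).getIso.inv) ≫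
        R.preimage (hR (R.map h)).getIso.hom = h := R.map_injective (by simp)
    have := t.app_map _ (not_isIso_preimage hR (R.map h) fun _ => hh (isIso_of_reflects_iso h R))
      (R.preimage (hR (R.map h)).getIso.hom) (by rwa [hi])
    simp only [Functor.comp_map, Functor.map_preimage, hi] at this
    exact this

lemma MatchingFamily.isFilling_restrict_iff
    (hR : ∀ ⦃y' : J'⦄, (R.obj x ⟶ y') → R.essImage y') {T S : C}
    (t : MatchingFamily f (R.obj x) T) (e : S ⟶ T) (s : S ⟶ A.obj (R.obj x)) :
    t.restrict.IsFilling e s ↔ t.IsFilling e s := by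
  refine ⟨fun hs => ⟨hs.comp_app, fun y' h hh => ?_⟩,
    fun hs => ⟨hs.comp_app, fun _ _ _ => hs.comp_map _ _⟩⟩
  let i := (hR h).getIso
  have hi : R.map (R.preimage (h ≫ i.inv)) ≫ i.hom = h := by simp
  have hk := hs.comp_map _ (not_isIso_preimage hR h hh)
  have ht := t.app_map (R.map (R.preimage (h ≫ i.inv)))
    (fun _ => not_isIso_preimage hR h hh (isIso_of_reflects_iso _ R)) i.hom (by rwa [hi])
  calc s ≫ A.map h = (s ≫ A.map (R.map (R.preimage (h ≫ i.inv)))) ≫ A.map i.hom := by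
        rw [Category.assoc, ← A.map_comp, hi]
    _ = e ≫ t.app h hh := by
        rw [show s ≫ A.map (R.map (R.preimage (h ≫ i.inv))) = _ from hk, Category.assoc]
        simp only [hi] at ht
        rw [← ht]
        rfl

lemma sameFillings_whiskerLeft (hR : ∀ ⦃y' : J'⦄, (R.obj x ⟶ y') → R.essImage y') :
    SameFillings (Functor.whiskerLeft R f) x f (R.obj x) := by
  refine ⟨Iso.refl _, fun T => ⟨fun t => ⟨t.extend hR, fun S e s => ?_⟩,
    fun t' => ⟨t'.restrict, fun S e s => ?_⟩⟩⟩
  · rw [Iso.refl_hom, Category.comp_id, ← MatchingFamily.isFilling_restrict_iff hR,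
      MatchingFamily.restrict_extend]
  · rw [Iso.refl_hom, Category.comp_id, MatchingFamily.isFilling_restrict_iff hR]

end Whisker
end Filling

/-! ### Prisms -/

section Prism

universe v₁ v₂ u₁ u₂

open scoped CategoryTheory.Prod

section

variable (J : Type u₁) [Category.{v₁} J] (C : Type u₂) [Category.{v₂} C]

/-- An arrow of `J`-diagrams as a diagram of shape `{0 → 1} × J`: the step from `n`-cubes to
`(n + 1)`-cubes. -/
def prism : Arrow (J ⥤ C) ⥤ (Bool × J ⥤ C) := arrowToFunctor (J ⥤ C) ⋙ Functor.uncurry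

end

variable {J : Type u₁} [Category.{v₁} J] {C : Type u₂} [Category.{v₂} C]

lemma prism_map_false_false (a : Arrow (J ⥤ C)) {x y : J} (h : (false, x) ⟶ (false, y)) :
    ((prism J C).obj a).map h = a.left.map h.2 :=
  Category.id_comp _

lemma prism_map_true_true (a : Arrow (J ⥤ C)) {x y : J} (h : (true, x) ⟶ (true, y)) :
    ((prism J C).obj a).map h = a.right.map h.2 :=
  Category.id_comp _

lemma not_hom_true_false {x y : J} (h : (true, x) ⟶ (false, y)) : False :=
  absurd (leOfHom (x := true) (y := false) h.1) (by decide)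

lemma not_isIso_false_true {x y : J} (h : (false, x) ⟶ (true, y)) : ¬ IsIso h := fun _ =>
  not_hom_true_false (inv h)

lemma isIso_iff_isIso_snd {b : Bool} {x y : J} (h : (b, x) ⟶ (b, y)) : IsIso h ↔ IsIso h.2 := by
  rw [isIso_prod_iff, and_iff_right]
  rw [Subsingleton.elim h.1 (𝟙 b)]
  infer_instance

/-- The morphism `p` is the pointwise comparison of the square `φ` of `J`-diagrams; see
`IsComparison`. -/
structure IsPointwiseComparison {a b : Arrow (J ⥤ C)} (φ : a ⟶ b) {P : J ⥤ C} (π₁ : P ⟶ a.right)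
    (π₂ : P ⟶ b.left) (p : a.left ⟶ P) : Prop where
  isPullback (x : J) : IsPullback (π₁.app x) (π₂.app x) (φ.right.app x) (b.hom.app x)
  fst : p ≫ π₁ = a.hom
  snd : p ≫ π₂ = φ.left

variable {a b : Arrow (J ⥤ C)} {φ : a ⟶ b} {P : J ⥤ C} {π₁ : P ⟶ a.right} {π₂ : P ⟶ b.left}
  {p : a.left ⟶ P} {x : J} {T S : C}

namespace IsPointwiseComparison

lemma app_comp_fst (hp : IsPointwiseComparison φ π₁ π₂ p) (x : J) :
    p.app x ≫ π₁.app x = a.hom.app x :=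
  NatTrans.congr_app hp.fst x

lemma app_comp_snd (hp : IsPointwiseComparison φ π₁ π₂ p) (x : J) :
    p.app x ≫ π₂.app x = φ.left.app x :=
  NatTrans.congr_app hp.snd x

end IsPointwiseComparison

namespace MatchingFamily

section

variable (t : MatchingFamily ((prism J C).map φ) (false, x) T)

/-- The base of a matching family at a vertex of the upper face of a prism. -/
def upperBase : T ⟶ b.left.obj x :=
  t.base

/-- The elements of the upper face in a matching family at one of its vertices. -/
def upper {y : J} (k : x ⟶ y) (hk : ¬ IsIso k) : T ⟶ a.left.obj y :=
  t.app (𝟙 false ×ₘ k) (by rwa [isIso_iff_isIso_snd])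

/-- The elements of the lower face in a matching family at a vertex of the upper face. -/
def lower {y : J} (k : x ⟶ y) : T ⟶ a.right.obj y :=
  t.app (homOfLE (Bool.false_le true) ×ₘ k) (not_isIso_false_true _)

lemma upper_map {y z : J} (k : x ⟶ y) (hk : ¬ IsIso k) (l : y ⟶ z) (hl : ¬ IsIso (k ≫ l)) :
    t.upper k hk ≫ a.left.map l = t.upper (k ≫ l) hl := by
  have := t.app_map (𝟙 false ×ₘ k) (by rwa [isIso_iff_isIso_snd]) (𝟙 false ×ₘ l)
    (by rwa [isIso_iff_isIso_snd])
  rwa [prism_map_false_false] at this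

lemma lower_map {y z : J} (k : x ⟶ y) (l : y ⟶ z) :
    t.lower k ≫ a.right.map l = t.lower (k ≫ l) := by
  have := t.app_map (homOfLE (Bool.false_le true) ×ₘ k) (not_isIso_false_true _) (𝟙 true ×ₘ l)
    (not_isIso_false_true _)
  rwa [prism_map_true_true] at this

lemma upper_comp_hom {y : J} (k : x ⟶ y) (hk : ¬ IsIso k) :
    t.upper k hk ≫ a.hom.app y = t.lower k := by
  have h₁ : t.upper k hk ≫ a.hom.app y ≫ a.right.map (𝟙 y) = t.lower (k ≫ 𝟙 y) :=
    t.app_map (𝟙 false ×ₘ k) (by rwa [isIso_iff_isIso_snd])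
      (homOfLE (Bool.false_le true) ×ₘ 𝟙 y) (not_isIso_false_true _)
  rwa [a.right.map_id, Category.comp_id, Category.comp_id] at h₁

lemma upper_comp_left {y : J} (k : x ⟶ y) (hk : ¬ IsIso k) :
    t.upper k hk ≫ φ.left.app y = t.upperBase ≫ b.left.map k := by
  have := t.app_comp (𝟙 false ×ₘ k) (by rwa [isIso_iff_isIso_snd])
  rwa [prism_map_false_false] at this

lemma lower_comp_right {y : J} (k : x ⟶ y) :
    t.lower k ≫ φ.right.app y = t.upperBase ≫ b.hom.app x ≫ b.right.map k :=
  t.app_comp _ (not_isIso_false_true _)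

end

/-- A matching family for a morphism of prisms at a vertex of the upper face, as a matching family
for its comparison. -/
noncomputable def toComparison (hp : IsPointwiseComparison φ π₁ π₂ p)
    (t : MatchingFamily ((prism J C).map φ) (false, x) T) : MatchingFamily p x T where
  base := (hp.isPullback x).lift (t.lower (𝟙 x)) t.upperBase (by
    rw [t.lower_comp_right, b.right.map_id, Category.comp_id])
  app y k hk := t.upper k hk
  app_map y z k hk l hl := t.upper_map k hk l hl
  app_comp y k hk := by
    apply (hp.isPullback y).hom_ext
    · rw [Category.assoc, hp.app_comp_fst, upper_comp_hom, Category.assoc, π₁.naturality,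
        IsPullback.lift_fst_assoc, lower_map, Category.id_comp]
    · rw [Category.assoc, hp.app_comp_snd, upper_comp_left, Category.assoc, π₂.naturality,
        IsPullback.lift_snd_assoc]

/-- A matching family for the comparison of a morphism of prisms, as a matching family for this
morphism. -/
def ofComparison (hp : IsPointwiseComparison φ π₁ π₂ p) (t : MatchingFamily p x T) :
    MatchingFamily ((prism J C).map φ) (false, x) T where
  base := t.base ≫ π₂.app x
  app
    | (false, _), h, hh => t.app h.2 (by rwa [← isIso_iff_isIso_snd])
    | (true, _), h, _ => t.base ≫ π₁.app x ≫ a.right.map h.2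
  app_map
    | (false, _), (false, _), h, hh, k, hk => by
      rw [prism_map_false_false]
      exact t.app_map _ _ _ _
    | (false, y), (true, z), h, hh, k, hk => by
      have ht : t.app h.2 _ ≫ p.app y = t.base ≫ P.map h.2 :=
        t.app_comp h.2 (by rwa [← isIso_iff_isIso_snd])
      change t.app h.2 _ ≫ a.hom.app y ≫ a.right.map k.2 =
        t.base ≫ π₁.app x ≫ a.right.map (h.2 ≫ k.2)
      rw [← hp.app_comp_fst, Category.assoc, reassoc_of% ht, π₁.naturality_assoc, a.right.map_comp]
    | (true, y), (true, z), h, hh, k, hk => by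
      rw [prism_map_true_true]
      change (t.base ≫ π₁.app x ≫ a.right.map h.2) ≫ a.right.map k.2 =
        t.base ≫ π₁.app x ≫ a.right.map (h.2 ≫ k.2)
      simp only [Category.assoc, a.right.map_comp]
    | (true, _), (false, _), h, hh, k, hk => (not_hom_true_false k).elim
  app_comp
    | (false, y), h, hh => by
      have ht : t.app h.2 _ ≫ p.app y = t.base ≫ P.map h.2 :=
        t.app_comp h.2 (by rwa [← isIso_iff_isIso_snd])
      rw [prism_map_false_false]
      change t.app h.2 _ ≫ φ.left.app y = (t.base ≫ π₂.app x) ≫ b.left.map h.2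
      rw [← hp.app_comp_snd, reassoc_of% ht, Category.assoc, π₂.naturality]
    | (true, y), h, hh => by
      change (t.base ≫ π₁.app x ≫ a.right.map h.2) ≫ φ.right.app y =
        (t.base ≫ π₂.app x) ≫ b.hom.app x ≫ b.right.map h.2
      simp only [Category.assoc, φ.right.naturality, (hp.isPullback x).w_assoc]

lemma ofComparison_toComparison (hp : IsPointwiseComparison φ π₁ π₂ p)
    (t : MatchingFamily ((prism J C).map φ) (false, x) T) :
    (t.toComparison hp).ofComparison hp = t := by
  ext ⟨_ | _, y⟩ h hh
  · exact IsPullback.lift_snd _ _ _ _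
  · rfl
  · have ht : (t.toComparison hp).base ≫ π₁.app x ≫ a.right.map h.2 = t.lower h.2 := by
      rw [toComparison, IsPullback.lift_fst_assoc, lower_map, Category.id_comp]
    exact ht

lemma isFilling_ofComparison_iff (hp : IsPointwiseComparison φ π₁ π₂ p)
    (t : MatchingFamily p x T) (e : S ⟶ T) (s : S ⟶ a.left.obj x) :
    (t.ofComparison hp).IsFilling e s ↔ t.IsFilling e s := by
  constructor
  · intro h
    refine ⟨(hp.isPullback x).hom_ext ?_ ?_, fun y k hk => ?_⟩
    · have hx : s ≫ a.hom.app x ≫ a.right.map (𝟙 x) = e ≫ t.base ≫ π₁.app x ≫ a.right.map (𝟙 x) :=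
        h.comp_map (homOfLE (Bool.false_le true) ×ₘ 𝟙 x) (not_isIso_false_true _)
      rw [a.right.map_id, Category.comp_id, Category.comp_id] at hx
      rw [Category.assoc, hp.app_comp_fst, hx, Category.assoc]
    · rw [Category.assoc, Category.assoc, hp.app_comp_snd]
      exact h.comp_app
    · have := h.comp_map (𝟙 false ×ₘ k) (by rwa [isIso_iff_isIso_snd])
      rwa [prism_map_false_false] at this
  · intro h
    refine ⟨?_, ?_⟩
    · change s ≫ φ.left.app x = e ≫ t.base ≫ π₂.app x
      rw [← hp.app_comp_snd, reassoc_of% h.comp_app]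
    · rintro ⟨_ | _, y⟩ k hk
      · rw [prism_map_false_false]
        exact h.comp_map _ _
      · change s ≫ a.hom.app x ≫ a.right.map k.2 = e ≫ t.base ≫ π₁.app x ≫ a.right.map k.2
        rw [← hp.app_comp_fst, Category.assoc, reassoc_of% h.comp_app]

end MatchingFamily

lemma sameFillings_prism_false (hp : IsPointwiseComparison φ π₁ π₂ p) (x : J) :
    SameFillings ((prism J C).map φ) (false, x) p x := by
  have hs {T S : C} (t : MatchingFamily p x T) (e : S ⟶ T) (s : S ⟶ a.left.obj x) :
      t.IsFilling e s ↔ t.IsFilling e (s ≫ (Iso.refl (a.left.obj x)).hom) := by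
    rw [Iso.refl_hom, Category.comp_id]
  refine ⟨Iso.refl (a.left.obj x), fun T => ⟨fun t => ⟨t.toComparison hp, fun S e s => ?_⟩,
    fun t' => ⟨t'.ofComparison hp, fun S e s => ?_⟩⟩⟩
  · have ht := (t.toComparison hp).isFilling_ofComparison_iff hp e s
    rw [t.ofComparison_toComparison hp] at ht
    exact ht.trans (hs _ e s)
  · exact (t'.isFilling_ofComparison_iff hp e s).trans (hs t' e s)

instance : (Prod.sectR true J).Full where
  map_surjective f := ⟨f.2, Prod.ext (Subsingleton.elim _ _) rfl⟩

instance : (Prod.sectR true J).Faithful where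
  map_injective h := congrArg Prod.snd h

/-- The lower face of a prism. -/
def sectRCompPrismIso (a : Arrow (J ⥤ C)) : Prod.sectR true J ⋙ (prism J C).obj a ≅ a.right :=
  NatIso.ofComponents (fun y => Iso.refl (a.right.obj y)) fun h =>
    (Category.comp_id _).trans
      ((prism_map_true_true a ((Prod.sectR true J).map h)).trans (Category.id_comp _).symm)

lemma sameFillings_prism_true (φ : a ⟶ b) (x : J) :
    SameFillings ((prism J C).map φ) (true, x) φ.right x := by
  have hR : ∀ ⦃y : Bool × J⦄, ((Prod.sectR true J).obj x ⟶ y) → (Prod.sectR true J).essImage y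
    | (true, y), _ => (Prod.sectR true J).obj_mem_essImage y
    | (false, _), h => (not_hom_true_false h).elim
  refine (sameFillings_whiskerLeft hR).symm.trans
    (sameFillings_of_iso (sectRCompPrismIso a) (sectRCompPrismIso b) ?_ x)
  ext y
  exact (Category.id_comp (φ.right.app y)).trans (Category.comp_id (φ.right.app y)).symm

section Cocone

/-- A constant diagram is the prism on an identity. -/
def constIsoPrism (J : Type u₁) [Category.{v₁} J] (Z : C) : (Functor.const (Bool × J)).obj Z ≅
    (prism J C).obj (Arrow.mk (𝟙 ((Functor.const J).obj Z))) :=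
  NatIso.ofComponents (fun | (false, _) => Iso.refl Z | (true, _) => Iso.refl Z) (by
    rintro ⟨_ | _, x⟩ ⟨_ | _, y⟩ h
    · exact show 𝟙 Z ≫ 𝟙 Z = 𝟙 Z ≫ 𝟙 Z ≫ 𝟙 Z by simp only [Category.comp_id]
    · exact show 𝟙 Z ≫ 𝟙 Z = 𝟙 Z ≫ 𝟙 Z ≫ 𝟙 Z by simp only [Category.comp_id]
    · exact (not_hom_true_false h).elim
    · exact show 𝟙 Z ≫ 𝟙 Z = 𝟙 Z ≫ 𝟙 Z ≫ 𝟙 Z by simp only [Category.comp_id])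

variable {Z : C} (g : (prism J C).obj a ⟶ (Functor.const _).obj Z)

/-- The restriction of a cocone on a prism to the lower face. -/
def lowerCocone : a.right ⟶ (Functor.const J).obj Z :=
  (sectRCompPrismIso a).inv ≫ Functor.whiskerLeft (Prod.sectR true J) g

/-- A cocone on a prism, as a morphism of arrows to an identity. -/
def coconeHom : a ⟶ Arrow.mk (𝟙 ((Functor.const J).obj Z)) :=
  Arrow.homMk (a.hom ≫ lowerCocone g) (lowerCocone g) (Category.comp_id _)

lemma prism_map_coconeHom : (prism J C).map (coconeHom g) = g ≫ (constIsoPrism J Z).hom := by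
  ext ⟨_ | _, y⟩
  · let h : ((false, y) : Bool × J) ⟶ (true, y) := homOfLE (Bool.false_le true) ×ₘ 𝟙 y
    have hg : (a.hom.app y ≫ a.right.map (𝟙 y)) ≫ g.app (true, y) = g.app (false, y) ≫ 𝟙 Z :=
      g.naturality h
    rw [a.right.map_id, Category.comp_id] at hg
    exact (congrArg (a.hom.app y ≫ ·) (Category.id_comp (g.app (true, y)))).trans hg
  · exact (Category.id_comp (g.app (true, y))).trans (Category.comp_id (g.app (true, y))).symm

lemma sameFillings_cocone (x : Bool × J) :
    SameFillings g x ((prism J C).map (coconeHom g)) x :=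
  sameFillings_of_iso (Iso.refl _) (constIsoPrism J Z)
    ((Category.id_comp _).trans (prism_map_coconeHom g)) x

lemma sameFillings_cocone_false (x : J) : SameFillings g (false, x) a.hom x :=
  (sameFillings_cocone g _).trans (sameFillings_prism_false (P := a.right) (π₁ := 𝟙 _)
    (π₂ := lowerCocone g) ⟨fun _ => IsPullback.id_horiz _, Category.comp_id _, rfl⟩ x)

lemma sameFillings_cocone_true (x : J) : SameFillings g (true, x) (lowerCocone g) x :=
  (sameFillings_cocone g _).trans (sameFillings_prism_true (coconeHom g) x)

end Cocone

section Base

variable {A B : J ⥤ C} {f : A ⟶ B} {x : J}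

/-- If nothing lies beyond `x`, then an element of `B.obj x` is a matching family. -/
def MatchingFamily.ofBase (hx : ∀ ⦃y : J⦄ (h : x ⟶ y), IsIso h) {T : C} (base : T ⟶ B.obj x) :
    MatchingFamily f x T where
  base := base
  app _ h hh := (hh (hx h)).elim
  app_map _ _ h hh := (hh (hx h)).elim
  app_comp _ h hh := (hh (hx h)).elim

lemma MatchingFamily.isFilling_iff (hx : ∀ ⦃y : J⦄ (h : x ⟶ y), IsIso h) {T S : C}
    (t : MatchingFamily f x T) (e : S ⟶ T) (s : S ⟶ A.obj x) :
    t.IsFilling e s ↔ s ≫ f.app x = e ≫ t.base :=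
  ⟨IsFilling.comp_app, fun h => ⟨h, fun _ h hh => (hh (hx h)).elim⟩⟩

lemma fillsUniquely_iff_isIso (hx : ∀ ⦃y : J⦄ (h : x ⟶ y), IsIso h) :
    FillsUniquely f x ↔ IsIso (f.app x) := by
  refine ⟨fun h => ?_, fun h T t => ⟨t.base ≫ inv (f.app x), ?_, fun s hs => ?_⟩⟩
  · obtain ⟨s, hs, -⟩ := h (.ofBase hx (𝟙 _))
    have hs' : s ≫ f.app x = 𝟙 _ :=
      ((MatchingFamily.isFilling_iff hx _ _ _).1 hs).trans (Category.comp_id _)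
    refine ⟨s, (h (.ofBase hx (f.app x))).unique ?_ ?_, hs'⟩
    all_goals simp [MatchingFamily.isFilling_iff hx, MatchingFamily.ofBase, hs']
  · simp [t.isFilling_iff hx]
  · have hs' := ((t.isFilling_iff hx _ _).1 hs).trans (Category.id_comp _)
    rw [← hs', Category.assoc, IsIso.hom_inv_id, Category.comp_id]

variable [Regular C]

lemma fillsLocally_iff_isRegularEpi (hx : ∀ ⦃y : J⦄ (h : x ⟶ y), IsIso h) :
    FillsLocally f x ↔ IsRegularEpi (f.app x) := by
  refine ⟨fun h => ?_, fun h T t => ?_⟩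
  · obtain ⟨S, e, s, he, hs⟩ := h (.ofBase hx (𝟙 _))
    have : StrongEpi (s ≫ f.app x) := by
      rw [hs.comp_app, MatchingFamily.ofBase, Category.comp_id]
      infer_instance
    exact (isRegularEpi_iff_strongEpi _).2 (strongEpi_of_strongEpi s _)
  · exact ⟨_, pullback.fst t.base (f.app x), pullback.snd _ _, inferInstance,
      (t.isFilling_iff hx _ _).2 pullback.condition.symm⟩

end Base

lemma FillsLocally.comp [Regular C] {A B D : J ⥤ C} {f : A ⟶ B} {g : B ⟶ D} {x : J}
    (hf : FillsLocally f x) (hg : FillsLocally g x) : FillsLocally (f ≫ g) x := by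
  intro T t
  let t₁ : MatchingFamily g x T :=
    { base := t.base
      app y h hh := t.app h hh ≫ f.app y
      app_map y z h hh k hk := by
        rw [Category.assoc, ← f.naturality, ← Category.assoc, t.app_map h hh k hk]
      app_comp y h hh := by
        rw [Category.assoc, ← NatTrans.comp_app, t.app_comp] }
  obtain ⟨S₁, e₁, s₁, he₁, hs₁⟩ := hg t₁
  let t₂ : MatchingFamily f x S₁ :=
    { base := s₁
      app y h hh := e₁ ≫ t.app h hh
      app_map y z h hh k hk := by
        rw [Category.assoc, t.app_map h hh k hk]
      app_comp y h hh := by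
        rw [Category.assoc, hs₁.comp_map h hh] }
  obtain ⟨S₂, e₂, s₂, he₂, hs₂⟩ := hf t₂
  refine ⟨S₂, e₂ ≫ e₁, s₂, ?_, ?_, fun y h hh => ?_⟩
  · exact (MorphismProperty.regularEpi C).comp_mem _ _ he₂ he₁
  · rw [NatTrans.comp_app, reassoc_of% hs₂.comp_app, hs₁.comp_app, Category.assoc]
  · rw [hs₂.comp_map h hh, Category.assoc]

end Prism

/-! ### Cubes -/

section SplitFirst

instance {n : ℕ} (x y : Fin n → Bool) : Subsingleton (x ⟶ y) :=
  inferInstanceAs (Subsingleton (∀ i, x i ⟶ y i))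

instance (n : ℕ) : (splitFirst n).Full where
  map_surjective f := ⟨Fin.cases f.1 f.2, rfl⟩

instance (n : ℕ) : (splitFirst n).Faithful where
  map_injective _ := Subsingleton.elim _ _

lemma splitFirst_surjective (n : ℕ) : Function.Surjective (splitFirst n).obj :=
  fun x => ⟨Fin.cons x.1 x.2, rfl⟩

instance (n : ℕ) : (splitFirst n).EssSurj :=
  Functor.essSurj_of_surj (splitFirst_surjective n)

instance (n : ℕ) : (splitFirst n).IsEquivalence where

end SplitFirst

section Cube

variable {C : Type (max u v)} [Category.{v} C] {n : ℕ}

/-- The underlying cube of an `(n + 1)`-fold extension, as an arrow between `n`-cubes. -/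
def NExt.cubeArrow (κ : NExt.{v, u} C (n + 1)) : Arrow (Cube C n) :=
  (cube.{v, u} C n).mapArrow.obj κ.toArrow

open NExt

/-- The underlying morphism of cubes of a morphism of `(n + 1)`-fold extensions, as a morphism of
arrows between `n`-cubes. -/
def NExt.cubeArrowMap {κ μ : NExt.{v, u} C (n + 1)} (f : κ ⟶ μ) : κ.cubeArrow ⟶ μ.cubeArrow :=
  (cube.{v, u} C n).mapArrow.map ((forget.{v, u} C n).map f)

lemma sameFillings_cube_prism {κ μ : NExt.{v, u} C (n + 1)} (f : κ ⟶ μ) (x : Fin (n + 1) → Bool) :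
    SameFillings ((cube.{v, u} C (n + 1)).map f) x ((prism _ C).map (cubeArrowMap f))
      ((splitFirst n).obj x) :=
  sameFillings_whiskerLeft fun y _ => Functor.EssSurj.mem_essImage (splitFirst n) y

lemma sameFillings_cube_true {κ μ : NExt.{v, u} C (n + 1)} (f : κ ⟶ μ) (x : Fin n → Bool) :
    SameFillings ((cube.{v, u} C (n + 1)).map f) (Fin.cons true x)
      ((cube.{v, u} C n).map (botMap f)) x :=
  (sameFillings_cube_prism f _).trans (sameFillings_prism_true (cubeArrowMap f) x)

variable [Regular C]

lemma isPullback_cube_map_app : ∀ {n : ℕ} {κ μ ν π : NExt.{v, u} C n} {a : π ⟶ κ} {b : π ⟶ ν}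
    {f : κ ⟶ μ} {g : ν ⟶ μ}, IsPullback a b f g → extensions.{v, u} C n f →
      ∀ x : Fin n → Bool, IsPullback (((cube.{v, u} C n).map a).app x)
        (((cube.{v, u} C n).map b).app x) (((cube.{v, u} C n).map f).app x)
        (((cube.{v, u} C n).map g).app x)
  | 0, _, _, _, _, _, _, _, _, h, _ => fun _ => h
  | _ + 1, _, _, _, _, _, _, _, _, h, hf => Fin.forall_fin_succ_pi.2 <| Bool.forall_bool.2
      ⟨isPullback_cube_map_app (isPullback_topMap h hf) (topMap_mem hf),
        isPullback_cube_map_app (isPullback_botMap h hf) (botMap_mem hf)⟩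

lemma sameFillings_cube_false {κ μ : NExt.{v, u} C (n + 1)} {f : κ ⟶ μ} {P : NExt.{v, u} C n}
    {p₁ : P ⟶ bot κ} {p₂ : P ⟶ top μ} {p : top κ ⟶ P}
    (hp : IsComparison (arr κ) (topMap f) (botMap f) (arr μ) p₁ p₂ p)
    (hf : extensions.{v, u} C n (botMap f)) (x : Fin n → Bool) :
    SameFillings ((cube.{v, u} C (n + 1)).map f) (Fin.cons false x)
      ((cube.{v, u} C n).map p) x := by
  have hp' : IsPointwiseComparison (cubeArrowMap f) ((cube.{v, u} C n).map p₁)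
      ((cube.{v, u} C n).map p₂) ((cube.{v, u} C n).map p) :=
    ⟨isPullback_cube_map_app hp.isPullback hf, ((cube.{v, u} C n).map_comp _ _).symm.trans
      (congrArg _ hp.fst), ((cube.{v, u} C n).map_comp _ _).symm.trans (congrArg _ hp.snd)⟩
  exact (sameFillings_cube_prism f _).trans (sameFillings_prism_false hp' x)

lemma isIso_of_hom_zero {x y : Fin 0 → Bool} (h : x ⟶ y) : IsIso h := by
  obtain rfl := Subsingleton.elim x y
  rw [Subsingleton.elim h (𝟙 x)]
  infer_instance

theorem mem_extensions_iff_fillsLocally : ∀ {n : ℕ} {κ μ : NExt.{v, u} C n} (f : κ ⟶ μ),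
    extensions.{v, u} C n f ↔ ∀ x, FillsLocally ((cube.{v, u} C n).map f) x
  | 0, _, _, f => by
    rw [Unique.forall_iff, fillsLocally_iff_isRegularEpi fun _ => isIso_of_hom_zero]
    rfl
  | n + 1, κ, μ, f => by
    rw [mem_succ_iff, Fin.forall_fin_succ_pi, Bool.forall_bool, and_comm (b := ∀ _, _),
      mem_extensions_iff_fillsLocally (botMap f)]
    simp only [(sameFillings_cube_true f _).fillsLocally_iff]
    refine and_congr_right fun hb => ?_
    replace hb := (mem_extensions_iff_fillsLocally (botMap f)).2 hb
    obtain ⟨P, p₁, p₂, hP⟩ := exists_isPullback_of_mem hb (arr μ)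
    have hp := isComparison_lift hP (w f)
    have hcomp : HasComparisonIn (extensions.{v, u} C n) (arr κ) (topMap f) (botMap f) (arr μ) ↔
        extensions.{v, u} C n _ := ⟨fun h => h.mem hp, fun h => ⟨_, _, _, _, hp, h⟩⟩
    rw [hcomp, mem_extensions_iff_fillsLocally]
    exact forall_congr' fun x => (sameFillings_cube_false hp hb x).fillsLocally_iff.symm

theorem discFib_iff_fillsUniquely : ∀ {n : ℕ} {κ μ : NExt.{v, u} C n} {f : κ ⟶ μ},
    extensions.{v, u} C n f → (discFib.{v, u} C n f ↔ FillsUniquely ((cube.{v, u} C n).map f) ⊥)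
  | 0, _, _, f, _ => (fillsUniquely_iff_isIso (f := (cube.{v, u} C 0).map f)
      fun _ => isIso_of_hom_zero).symm
  | n + 1, κ, μ, f, hf => by
    obtain ⟨P, p₁, p₂, p, hp, hpE⟩ := exists_isComparison hf
    have hbot : (⊥ : Fin (n + 1) → Bool) = Fin.cons false ⊥ := (Fin.cons_self_tail ⊥).symm
    rw [hbot, (sameFillings_cube_false hp (botMap_mem hf) ⊥).fillsUniquely_iff,
      ← discFib_iff_fillsUniquely hpE]
    exact ⟨fun h => h.2.mem hp, fun h => ⟨botMap_mem hf, P, p₁, p₂, p, hp, h⟩⟩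

end Cube

section LimitCube

section

variable {C : Type u} [Category.{v} C] {n : ℕ} {X : Cube C n} {Z T : C}
  {g : X ⟶ (Functor.const _).obj Z}

lemma isIso_bot_iff {x : Fin n → Bool} (h : ⊥ ⟶ x) : IsIso h ↔ x = ⊥ := by
  refine ⟨fun _ => le_bot_iff.1 fun i => leOfHom (inv h i), ?_⟩
  rintro rfl
  rw [Subsingleton.elim h (𝟙 ⊥)]
  infer_instance

/-- A cone on the complement of the initial vertex, as a matching family for a map to a terminal
object. -/
def MatchingFamily.ofCone (hZ : IsTerminal Z)
    (c : Cone ((ObjectProperty.ι fun x : Fin n → Bool => x ≠ ⊥) ⋙ X)) :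
    MatchingFamily g ⊥ c.pt where
  base := hZ.from _
  app y h hh := c.π.app ⟨y, by rwa [Ne, ← isIso_bot_iff h]⟩
  app_map y z h hh k hk := c.w (j := ⟨y, by rwa [Ne, ← isIso_bot_iff h]⟩)
    (j' := ⟨z, by rwa [Ne, ← isIso_bot_iff (h ≫ k)]⟩) (ObjectProperty.homMk k)
  app_comp _ _ _ := hZ.hom_ext _ _

/-- A matching family at the initial vertex, as a cone on its complement. -/
def MatchingFamily.toCone (t : MatchingFamily g ⊥ T) :
    Cone ((ObjectProperty.ι fun x : Fin n → Bool => x ≠ ⊥) ⋙ X) where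
  pt := T
  π :=
    { app x := t.app (fun _ => homOfLE bot_le) ((isIso_bot_iff _).not.2 x.property)
      naturality x y f := by
        refine (Category.id_comp _).trans (Eq.symm ?_)
        exact t.app_map _ ((isIso_bot_iff _).not.2 x.property) f.hom
          ((isIso_bot_iff _).not.2 y.property) }

lemma MatchingFamily.ofCone_toCone (hZ : IsTerminal Z) (t : MatchingFamily g ⊥ T) :
    ofCone hZ t.toCone = t := by
  ext y h hh
  · exact hZ.hom_ext _ _
  · rfl

lemma MatchingFamily.isFilling_ofCone_iff (hZ : IsTerminal Z)
    (c : Cone ((ObjectProperty.ι fun x : Fin n → Bool => x ≠ ⊥) ⋙ X)) (s : c.pt ⟶ X.obj ⊥) :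
    (ofCone (g := g) hZ c).IsFilling (𝟙 _) s ↔ ∀ x, s ≫ X.initialCone.π.app x = c.π.app x := by
  refine ⟨fun h x => ?_, fun h => ⟨hZ.hom_ext _ _, fun y k hk => ?_⟩⟩
  · exact (h.comp_map _ ((isIso_bot_iff _).not.2 x.property)).trans (Category.id_comp _)
  · rw [Category.id_comp]
    exact h ⟨y, by rwa [Ne, ← isIso_bot_iff k]⟩

lemma isLimitCube_iff_fillsUniquely (hZ : IsTerminal Z) (g : X ⟶ (Functor.const _).obj Z) :
    X.IsLimitCube ↔ FillsUniquely g ⊥ := by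
  refine ⟨fun ⟨h⟩ T t => ?_, fun h => ⟨.ofExistsUnique fun c => ?_⟩⟩
  · rw [← t.ofCone_toCone hZ]
    exact (existsUnique_congr fun s => MatchingFamily.isFilling_ofCone_iff hZ t.toCone s).2
      (h.existsUnique t.toCone)
  · exact (existsUnique_congr fun s => MatchingFamily.isFilling_ofCone_iff hZ c s).1
      (h (.ofCone hZ c))

end

variable {C : Type (max u v)} [Category.{v} C] [Regular C] {n : ℕ}

open NExt

lemma isDiscreteFibration_iff_discFib {κ μ : NExt.{v, u} C n} (φ : κ ⟶ μ) :
    IsDiscreteFibration φ ↔ discFib.{v, u} C n φ := by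
  have key (h : extensions.{v, u} C n φ) :
      ((cube.{v, u} C (n + 1)).obj (NExt.ofHom φ h)).IsLimitCube ↔ discFib.{v, u} C n φ := by
    let g : (prism _ C).obj (NExt.ofHom φ h).cubeArrow ⟶ (Functor.const _).obj (⊤_ C) :=
      { app _ := terminal.from _ }
    have hg : SameFillings (Functor.whiskerLeft (splitFirst n) g) ⊥ ((cube.{v, u} C n).map φ) ⊥ :=
      (sameFillings_whiskerLeft fun y _ => Functor.EssSurj.mem_essImage (splitFirst n) y).trans
        (sameFillings_cocone_false g ⊥)
    exact (isLimitCube_iff_fillsUniquely terminalIsTerminal _).trans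
      (hg.fillsUniquely_iff.trans (discFib_iff_fillsUniquely h).symm)
  exact ⟨fun ⟨h, hφ⟩ => (key h).1 hφ, fun hφ => ⟨_, (key (discFib_le_extensions n φ hφ)).2 hφ⟩⟩

end LimitCube

section ArrowFunctors

universe v₁ v₂ u₁ u₂

variable {D : Type u₁} [Category.{v₁} D]

instance : (arrowToFunctor D).Full where
  map_surjective {f g} φ := by
    have hw : f.hom ≫ φ.app true = φ.app false ≫ g.hom :=
      φ.naturality (homOfLE (Bool.false_le true))
    refine ⟨Arrow.homMk (φ.app false) (φ.app true) hw.symm, ?_⟩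
    ext (_ | _) <;> rfl

instance : (arrowToFunctor D).Faithful where
  map_injective h :=
    Arrow.hom_ext _ _ (NatTrans.congr_app h false) (NatTrans.congr_app h true)

instance : (arrowToFunctor D).EssSurj where
  mem_essImage F := by
    refine ⟨Arrow.mk (F.map (homOfLE (Bool.false_le true))), ⟨NatIso.ofComponents
      (fun | false => Iso.refl (F.obj false) | true => Iso.refl (F.obj true)) ?_⟩⟩
    rintro (_ | _) (_ | _) h
    · exact (Category.comp_id _).trans ((F.map_id _).symm.trans (Category.id_comp _).symm)
    · exact (Category.comp_id _).trans (Category.id_comp _).symm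
    · exact absurd (leOfHom h) (by decide)
    · exact (Category.comp_id _).trans ((F.map_id _).symm.trans (Category.id_comp _).symm)

variable {D' : Type u₂} [Category.{v₂} D'] (F : D ⥤ D')

instance mapArrow_faithful [F.Faithful] : F.mapArrow.Faithful where
  map_injective h := Arrow.hom_ext _ _ (F.map_injective (congrArg CommaMorphism.left h))
    (F.map_injective (congrArg CommaMorphism.right h))

instance mapArrow_full [F.Full] [F.Faithful] : F.mapArrow.Full where
  map_surjective {f g} φ := by
    obtain ⟨l, hl⟩ := F.map_surjective (X := f.left) (Y := g.left) φ.left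
    obtain ⟨r, hr⟩ := F.map_surjective (X := f.right) (Y := g.right) φ.right
    have hφ : φ.left ≫ F.map g.hom = F.map f.hom ≫ φ.right := Arrow.w φ
    refine ⟨Arrow.homMk l r (F.map_injective ?_), Arrow.hom_ext _ _ hl hr⟩
    rw [F.map_comp, F.map_comp, hl, hr]
    exact hφ

end ArrowFunctors

section FullyFaithful

variable {C : Type (max u v)} [Category.{v} C]

instance (n : ℕ) : (NExt.forget.{v, u} C n).Full :=
  inferInstanceAs (ObjectProperty.ι _).Full

instance (n : ℕ) : (NExt.forget.{v, u} C n).Faithful :=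
  inferInstanceAs (ObjectProperty.ι _).Faithful

instance cube_faithful : ∀ n : ℕ, (cube.{v, u} C n).Faithful
  | 0 => inferInstanceAs (Functor.const (Fin 0 → Bool) : C ⥤ _).Faithful
  | n + 1 =>
    have := cube_faithful n
    inferInstanceAs (NExt.forget.{v, u} C n ⋙ (cube.{v, u} C n).mapArrow ⋙
      arrowToFunctor (Cube C n) ⋙ Functor.uncurry ⋙
        (Functor.whiskeringLeft _ _ _).obj (splitFirst n)).Faithful

instance cube_full : ∀ n : ℕ, (cube.{v, u} C n).Full
  | 0 =>
    { map_surjective φ :=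
        ⟨φ.app ⊥, NatTrans.ext (funext fun x => by rw [Subsingleton.elim x ⊥]; rfl)⟩ }
  | n + 1 =>
    have := cube_full n
    inferInstanceAs (NExt.forget.{v, u} C n ⋙ (cube.{v, u} C n).mapArrow ⋙
      arrowToFunctor (Cube C n) ⋙ Functor.uncurry ⋙
        (Functor.whiskeringLeft _ _ _).obj (splitFirst n)).Full

lemma exists_cube_succ_iso {C : Type u} [Category.{v} C] {n : ℕ} (X : Cube C (n + 1)) :
    ∃ a : Arrow (Cube C n), Nonempty (splitFirst n ⋙ (prism _ C).obj a ≅ X) := by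
  have : (Functor.uncurry : (Bool ⥤ Cube C n) ⥤ _).EssSurj :=
    (Functor.currying (C := Bool) (D := Fin n → Bool) (E := C)).essSurj_functor
  have : (prism (Fin n → Bool) C).EssSurj :=
    inferInstanceAs (arrowToFunctor (Cube C n) ⋙ Functor.uncurry).EssSurj
  exact Functor.EssSurj.mem_essImage
    (prism (Fin n → Bool) C ⋙ (Functor.whiskeringLeft _ _ _).obj (splitFirst n)) X

end FullyFaithful

/-! ### Cubes which underlie extensions -/

section LocallyFilled

universe v₁ v₂ v₃ u₁ u₂ u₃

variable {J : Type u₁} [Category.{v₁} J] {C : Type u₂} [Category.{v₂} C]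

/-- A diagram whose filling problems over some constant diagram can be solved locally. The cubes
with this property are those which underlie extensions; see `isLocallyFilled_cube` and
`IsLocallyFilled.mem_essImage_cube`. -/
def IsLocallyFilled (X : J ⥤ C) : Prop :=
  ∃ (Z : C) (g : X ⟶ (Functor.const J).obj Z), ∀ x, FillsLocally g x

lemma IsLocallyFilled.of_iso {X Y : J ⥤ C} (e : X ≅ Y) : IsLocallyFilled X → IsLocallyFilled Y :=
  fun ⟨Z, g, hg⟩ => ⟨Z, e.inv ≫ g, fun x =>
    (sameFillings_of_iso e (Iso.refl _) (by simp) x).fillsLocally (hg x)⟩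

lemma isLocallyFilled_comp_iff {J' : Type u₃} [Category.{v₃} J'] {R : J' ⥤ J} [R.Full]
    [R.Faithful] (hR : Function.Surjective R.obj) {X : J ⥤ C} :
    IsLocallyFilled (R ⋙ X) ↔ IsLocallyFilled X := by
  have := Functor.essSurj_of_surj hR
  have : R.IsEquivalence := {}
  have hR' {Z : C} (g : X ⟶ (Functor.const J).obj Z) (y : J') :
      SameFillings (Functor.whiskerLeft R g) y g (R.obj y) :=
    sameFillings_whiskerLeft fun x _ => Functor.EssSurj.mem_essImage R x
  refine ⟨fun ⟨Z, g, hg⟩ => ?_, fun ⟨Z, g, hg⟩ =>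
    ⟨Z, Functor.whiskerLeft R g, fun y => (hR' g y).symm.fillsLocally (hg _)⟩⟩
  obtain ⟨g, rfl⟩ := ((Functor.whiskeringLeft J' J C).obj R).map_surjective
    (Y := (Functor.const J).obj Z) g
  exact ⟨Z, g, hR.forall.2 fun y => (hR' g y).fillsLocally (hg y)⟩

lemma isLocallyFilled_prism_iff {a : Arrow (J ⥤ C)} :
    IsLocallyFilled ((prism J C).obj a) ↔
      (∀ x, FillsLocally a.hom x) ∧ IsLocallyFilled a.right := by
  refine ⟨fun ⟨Z, g, hg⟩ => ⟨fun x => (sameFillings_cocone_false g x).fillsLocally (hg _),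
    Z, lowerCocone g, fun x => (sameFillings_cocone_true g x).fillsLocally (hg _)⟩,
    fun ⟨ha, Z, g, hg⟩ => ?_⟩
  let φ : a ⟶ Arrow.mk (𝟙 ((Functor.const J).obj Z)) := Arrow.homMk (a.hom ≫ g) g (by simp)
  let g' : (prism J C).obj a ⟶ (Functor.const _).obj Z :=
    (prism J C).map φ ≫ (constIsoPrism J Z).inv
  have hg' (x : Bool × J) : SameFillings ((prism J C).map φ) x g' x :=
    sameFillings_of_iso (Iso.refl _) (constIsoPrism J Z).symm (Category.id_comp _) x
  refine ⟨Z, g', Prod.forall.2 (Bool.forall_bool.2 ⟨fun x => ?_, fun x => ?_⟩)⟩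
  · exact (sameFillings_cocone_false g' x).symm.fillsLocally (ha x)
  · exact ((sameFillings_prism_true φ x).symm.trans (hg' _)).fillsLocally (hg x)

lemma IsLocallyFilled.of_hom [Regular C] {X Y : J ⥤ C} {f : X ⟶ Y}
    (hf : ∀ x, FillsLocally f x) : IsLocallyFilled Y → IsLocallyFilled X :=
  fun ⟨Z, g, hg⟩ => ⟨Z, f ≫ g, fun x => (hf x).comp (hg x)⟩

end LocallyFilled

section EssImage

variable {C : Type (max u v)} [Category.{v} C]

variable [Regular C]

lemma isLocallyFilled_cube : ∀ {n : ℕ} (κ : NExt.{v, u} C n),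
    IsLocallyFilled ((cube.{v, u} C n).obj κ)
  | 0, κ => ⟨κ, 𝟙 _, fun _ => (fillsLocally_iff_isRegularEpi fun _ => isIso_of_hom_zero).2
      (inferInstanceAs (IsRegularEpi (𝟙 _)))⟩
  | _ + 1, κ => (isLocallyFilled_comp_iff (splitFirst_surjective _)).2 <|
      isLocallyFilled_prism_iff.2 ⟨(mem_extensions_iff_fillsLocally (NExt.arr κ)).1 κ.arr_mem,
        isLocallyFilled_cube (NExt.bot κ)⟩

theorem IsLocallyFilled.mem_essImage_cube : ∀ {n : ℕ} {X : Cube C n},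
    IsLocallyFilled X → (cube.{v, u} C n).essImage X
  | 0, X, _ => ⟨X.obj ⊥, ⟨NatIso.ofComponents
      (fun x => X.mapIso (eqToIso (Subsingleton.elim ⊥ x))) fun h =>
        (Category.id_comp _).trans <| (congrArg X.map (Subsingleton.elim _ _)).trans
          (X.map_comp _ h)⟩⟩
  | n + 1, X, hX => by
    obtain ⟨a, ⟨i⟩⟩ := exists_cube_succ_iso X
    obtain ⟨ha, hr⟩ := isLocallyFilled_prism_iff.1
      ((isLocallyFilled_comp_iff (splitFirst_surjective _)).1 (hX.of_iso i.symm))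
    obtain ⟨B, ⟨eB⟩⟩ := hr.mem_essImage_cube
    obtain ⟨A, ⟨eA⟩⟩ := (hr.of_hom ha).mem_essImage_cube
    obtain ⟨f, hf⟩ := (cube.{v, u} C n).map_surjective (eA.hom ≫ a.hom ≫ eB.inv)
    have hw : eA.hom ≫ a.hom = (cube.{v, u} C n).map f ≫ eB.hom := by
      rw [hf, Category.assoc, Category.assoc, Iso.inv_hom_id, Category.comp_id]
    have hfE : extensions.{v, u} C n f := (mem_extensions_iff_fillsLocally f).2 fun x =>
      (sameFillings_of_iso eA.symm eB.symm (by simp [hf]) x).fillsLocally (ha x)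
    have e : (NExt.ofHom f hfE).cubeArrow ≅ a := Arrow.isoMk eA eB hw
    exact ⟨NExt.ofHom f hfE, ⟨Functor.isoWhiskerLeft (splitFirst n) ((prism _ C).mapIso e) ≪≫ i⟩⟩

end EssImage

/-! ### Permutations of the directions -/

section Reindex

variable {n : ℕ}

/-- The action of a permutation of the directions on the vertices of the cube, so that
`X.permute σ` is `reindex σ ⋙ X`. -/
def reindex (σ : Equiv.Perm (Fin n)) : (Fin n → Bool) ⥤ (Fin n → Bool) where
  obj x i := x (σ.symm i)
  map h i := h (σ.symm i)

lemma reindex_surjective (σ : Equiv.Perm (Fin n)) : Function.Surjective (reindex σ).obj :=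
  fun x => ⟨fun i => x (σ i), funext fun i => congrArg x (σ.apply_symm_apply i)⟩

instance (σ : Equiv.Perm (Fin n)) : (reindex σ).Full where
  map_surjective f := 
    ⟨fun i => homOfLE (by simpa [reindex] using leOfHom (f (σ i))), Subsingleton.elim _ _⟩

instance (σ : Equiv.Perm (Fin n)) : (reindex σ).Faithful where
  map_injective _ := Subsingleton.elim _ _

end Reindex

section Permute

variable {C : Type (max u v)} [Category.{v} C] {n : ℕ} {σ : Equiv.Perm (Fin n)}

lemma nonempty_iso_permute_inv {X Y : Cube C n} (e : Y ≅ X.permute σ) :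
    Nonempty (X ≅ Y.permute σ⁻¹) := by
  have hX : (X.permute σ).permute σ⁻¹ = X.permute (σ * σ⁻¹) := rfl
  rw [mul_inv_cancel] at hX
  exact ⟨(eqToIso hX).symm ≪≫ Functor.isoWhiskerLeft (reindex σ⁻¹) e.symm⟩

variable [Regular C]

lemma exists_iso_permute (σ : Equiv.Perm (Fin n)) (α : NExt.{v, u} C n) :
    ∃ α' : NExt.{v, u} C n,
      Nonempty ((cube.{v, u} C n).obj α' ≅ ((cube.{v, u} C n).obj α).permute σ) :=
  ((isLocallyFilled_comp_iff (reindex_surjective σ)).2 (isLocallyFilled_cube α)).mem_essImage_cube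

lemma exists_discFib_of_permute {τ α τ' α' : NExt.{v, u} C n}
    (eτ : (cube.{v, u} C n).obj τ' ≅ reindex σ ⋙ (cube.{v, u} C n).obj τ)
    (eα : (cube.{v, u} C n).obj α' ≅ reindex σ ⋙ (cube.{v, u} C n).obj α)
    {φ : τ ⟶ α} (hφ : NExt.discFib.{v, u} C n φ) :
    ∃ φ' : τ' ⟶ α', NExt.discFib.{v, u} C n φ' := by
  obtain ⟨φ', hφ'⟩ := (cube.{v, u} C n).map_surjective
    (eτ.hom ≫ Functor.whiskerLeft (reindex σ) ((cube.{v, u} C n).map φ) ≫ eα.inv)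
  have := Functor.essSurj_of_surj (reindex_surjective σ)
  have hw : eτ.hom ≫ Functor.whiskerLeft (reindex σ) ((cube.{v, u} C n).map φ) =
      (cube.{v, u} C n).map φ' ≫ eα.hom := by
    rw [hφ', Category.assoc, Category.assoc, eα.inv_hom_id, Category.comp_id]
  have hfill (x : Fin n → Bool) : SameFillings ((cube.{v, u} C n).map φ') x
      ((cube.{v, u} C n).map φ) ((reindex σ).obj x) :=
    (sameFillings_of_iso eτ eα hw x).trans
      (sameFillings_whiskerLeft fun y _ => Functor.EssSurj.mem_essImage (reindex σ) y)
  have hφE := NExt.discFib_le_extensions n φ hφ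
  have hφE' : extensions.{v, u} C n φ' := (mem_extensions_iff_fillsLocally φ').2 fun x =>
    (hfill x).fillsLocally_iff.2 ((mem_extensions_iff_fillsLocally φ).1 hφE _)
  exact ⟨φ', (discFib_iff_fillsUniquely hφE').2
    ((hfill ⊥).fillsUniquely_iff.2 ((discFib_iff_fillsUniquely hφE).1 hφ))⟩

end Permute

namespace GaloisTower

variable {C : Type (max u v)} [Category.{v} C] {T : GaloisTower.{v, u} C}

lemma liesInBase_iff : ∀ {n : ℕ} (β : NExt.{v, u} C n), T.LiesInBase β ↔ T.VerticesInBase n β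
  | 0, _ => Unique.forall_iff
  | _ + 1, β => Fin.forall_fin_succ_pi.trans <| Bool.forall_bool.trans <|
      and_congr (liesInBase_iff (NExt.top β)) (liesInBase_iff (NExt.bot β))

lemma LiesInBase.permute {n : ℕ} {σ : Equiv.Perm (Fin n)} {β β' : NExt.{v, u} C n}
    (hβ : T.LiesInBase β)
    (e : (cube.{v, u} C n).obj β' ≅ ((cube.{v, u} C n).obj β).permute σ) : T.LiesInBase β' :=
  have := (T.Γ 0).replete
  fun x => (T.Γ 0).X.prop_of_iso (e.app x).symm (hβ _)

lemma isSymmetricCovering_iff_exists_span {n : ℕ} (α : NExt.{v, u} C n) :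
    T.IsSymmetricCovering α ↔ ∃ (β τ : NExt.{v, u} C n) (φ : τ ⟶ β) (ψ : τ ⟶ α),
      IsDiscreteFibration φ ∧ IsDiscreteFibration ψ ∧ T.LiesInBase β :=
  ⟨fun ⟨τ, ψ, hψ, β, φ, hφ, hβ⟩ => ⟨β, τ, φ, ψ, hφ, hψ, hβ⟩,
    fun ⟨β, τ, φ, ψ, hφ, hψ, hβ⟩ => ⟨τ, ψ, hψ, β, φ, hφ, hβ⟩⟩

variable [Regular C] {n : ℕ}

theorem isCovering_iff_exists_span (α : NExt.{v, u} C (n + 1)) :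
    T.IsCovering α ↔ ∃ (β τ : NExt.{v, u} C (n + 1)) (φ : τ ⟶ β) (ψ : τ ⟶ α),
      IsDiscreteFibration φ ∧ IsDiscreteFibration ψ ∧ T.LiesInBase β := by
  simp only [isDiscreteFibration_iff_discFib, liesInBase_iff]
  exact isCovering_iff_exists_span_discFib α

variable {σ : Equiv.Perm (Fin (n + 1))} {α α' : NExt.{v, u} C (n + 1)}

lemma IsCovering.permute (hα : T.IsCovering α)
    (e : (cube.{v, u} C (n + 1)).obj α' ≅ ((cube.{v, u} C (n + 1)).obj α).permute σ) :
    T.IsCovering α' := by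
  obtain ⟨β, τ, φ, ψ, hφ, hψ, hβ⟩ := (isCovering_iff_exists_span α).1 hα
  obtain ⟨β', ⟨eβ⟩⟩ := exists_iso_permute σ β
  obtain ⟨τ', ⟨eτ⟩⟩ := exists_iso_permute σ τ
  rw [isDiscreteFibration_iff_discFib] at hφ hψ
  obtain ⟨φ', hφ'⟩ := exists_discFib_of_permute eτ eβ hφ
  obtain ⟨ψ', hψ'⟩ := exists_discFib_of_permute eτ e hψ
  rw [← isDiscreteFibration_iff_discFib] at hφ' hψ'
  exact (isCovering_iff_exists_span α').2 ⟨β', τ', φ', ψ', hφ', hψ', hβ.permute eβ⟩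

theorem isCovering_iff_of_permute
    (e : (cube.{v, u} C (n + 1)).obj α' ≅ ((cube.{v, u} C (n + 1)).obj α).permute σ) :
    T.IsCovering α ↔ T.IsCovering α' :=
  ⟨fun h => h.permute e, fun h =>
    (nonempty_iso_permute_inv e).elim fun e' => IsCovering.permute h e'⟩

end GaloisTower

end HigherCoverings

open CategoryTheory HigherCoverings in
theorem mainTheorem1_general {C : Type (max u v)} [Category.{v} C] [Regular C]
    (T : GaloisTower.{v, u} C) (n : ℕ) (α : NExt.{v, u} C (n + 1)) :
    (T.IsCovering α ↔ T.IsSymmetricCovering α) ∧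
    (T.IsCovering α ↔
      ∃ (β τ : NExt.{v, u} C (n + 1)) (φ : τ ⟶ β) (ψ : τ ⟶ α),
        IsDiscreteFibration φ ∧ IsDiscreteFibration ψ ∧ T.LiesInBase β) ∧
    (∀ σ : Equiv.Perm (Fin (n + 1)),
      (∃ α' : NExt.{v, u} C (n + 1),
        Nonempty ((cube.{v, u} C (n + 1)).obj α' ≅
          ((cube.{v, u} C (n + 1)).obj α).permute σ)) ∧
      ∀ α' : NExt.{v, u} C (n + 1),
        Nonempty ((cube.{v, u} C (n + 1)).obj α' ≅
          ((cube.{v, u} C (n + 1)).obj α).permute σ) →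
        (T.IsCovering α ↔ T.IsCovering α')) := by
  have hspan := GaloisTower.isCovering_iff_exists_span (T := T) α
  exact ⟨hspan.trans (GaloisTower.isSymmetricCovering_iff_exists_span α).symm, hspan, fun σ =>
    ⟨exists_iso_permute σ α, fun _ ⟨e⟩ => GaloisTower.isCovering_iff_of_permute e⟩⟩

open CategoryTheory HigherCoverings in
/-- Here `α` is an `(n + 1)`-fold extension, with `n + 1 ≥ 2`. The last part says that permuting the
directions of the underlying cube of `α` yields again an `(n + 1)`-fold extension (unique up to
isomorphism), and that this is a covering if and only if `α` is one. -/
theorem mainTheorem1 {C : Type (max u v)} [Category.{v} C] [BarrExact C]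
    (T : GaloisTower.{v, u} C) (n : ℕ) (hn : 2 ≤ n + 1) (α : NExt.{v, u} C (n + 1)) :
    (T.IsCovering α ↔ T.IsSymmetricCovering α) ∧
    (T.IsCovering α ↔
      ∃ (β τ : NExt.{v, u} C (n + 1)) (φ : τ ⟶ β) (ψ : τ ⟶ α),
        IsDiscreteFibration φ ∧ IsDiscreteFibration ψ ∧ T.LiesInBase β) ∧
    (∀ σ : Equiv.Perm (Fin (n + 1)),
      (∃ α' : NExt.{v, u} C (n + 1),
        Nonempty ((cube.{v, u} C (n + 1)).obj α' ≅
          ((cube.{v, u} C (n + 1)).obj α).permute σ)) ∧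
      ∀ α' : NExt.{v, u} C (n + 1),
        Nonempty ((cube.{v, u} C (n + 1)).obj α' ≅
          ((cube.{v, u} C (n + 1)).obj α).permute σ) →
        (T.IsCovering α ↔ T.IsCovering α')) :=
  mainTheorem1_general T n α
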